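/- **Setting.** A *problem* is a tuple $f_1,\dots,f_M:\mathbb R^S\to\mathbb R$ (for some dimension $S$), with $f(x)=\frac1M\sum_{i=1}^M f_i(x_i)$ for $x=(x_1,\dots,x_M)\in(\mathbb R^S)^M$. It is in $\mathcal P^M_U$ if every $f_i$ is differentiable, the smallest Lipschitz constant of each $\nabla f_i$ is $U$, and $\inf f>-\infty$. Put $d_0=(\nabla f_1(0),\dots,\nabla f_M(0))$. $\mathcal N^M_D$ is the class of connected, undirected, unweighted graphs $\mathcal G$ on the nodes $1,\dots,M$ with diameter $D$. With $d_i$ the degrees and $P=\mathrm{diag}(d_1,\dots,d_M)$, the Laplacian $\mathcal L$ has entries $1$ on the diagonal, $-1/\sqrt{d_id_j}$ if $i\sim j$, and $0$ otherwise. $\underline\lambda_{\min}$ and $\lambda_{\max}$ denote the smallest nonzero and the largest eigenvalue, and $\xi(\mathcal G)=\underline\lambda_{\min}(\mathcal L)/\lambda_{\max}(\mathcal L)$. An *algorithm* produces, for every network and every problem, iterates $x_i^t$ ($i=1,\dots,M$, $t\ge0$) with $x_i^0=0$. It is in $\mathcal A$ if there are linear operators, which may depend on the network and on the dimension but not on the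 problem, namely $Q_i^t:\mathbb R^S\to\mathbb R^S$ and the blocks of $W_i^t$ (one linear map $\mathbb R^S\to\mathbb R^S$ for each argument), such that, with $v_j^k=Q_j^k(x_j^k)$, whenever the network is connected and the $f_i$ are differentiable, $$x_i^{t+1}\in W_i^t\big(\{v_j^k\}_{j\sim i},\ \nabla f_i(x_i^k),\ x_i^k\ :\ 0\le k\le t\big),$$ where the right-hand side is the set of all linear combinations of the images of the arguments under the corresponding blocks. It is in $\mathcal A'$ if the same holds with the messages $\{v_j^k\}_{j\sim i}$ replaced by their sums $\sum_{j\sim i}v_j^k$. For $t\ge1$ let $$h^*_t=\min_{1\le s\le t}\ \Big\|\frac1M\sum_{i=1}^M\nabla f_i(x_i^s)\Big\|^2+\frac{U}{M\,\underline\lambda_{\min}(P^{1/2}\mathcal LP^{1/2})}\sum_{\{i,j\}:\,i\sim j}\|x_i^s-x_j^s\|^2 ,$$ where each edge is counted once. **Corollary 3.1.** Let $U\in(0,1)$, $\epsilon>0$, $\Delta>0$, and let $D,M$ be integers with $1\le D\le M-1$. For every algorithm in $\mathcal A$ or $\mathcal A'$ there exist a problem in $\mathcal P^M_U$ with $$f(0)-\inf_x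 f(x)+\frac{\|d_0\|^2}{MU}=\Delta$$ and a network $\mathcal G\in\mathcal N^M_D$ such that every $t\ge1$ with $h^*_t<\epsilon$ satisfies both $$t\ \ge\ \frac D3\left\lfloor\frac{\big(f(0)-\inf_x f(x)+\frac{\|d_0\|^2}{MU}\big)U}{1650\pi^2}\,\epsilon^{-1}\right\rfloor$$ and $$t\ \ge\ \frac{\sqrt{(D-1)/(2M)}}{3\sqrt{\xi(\mathcal G)}}\left\lfloor\frac{\big(f(0)-\inf_x f(x)+\frac{\|d_0\|^2}{MU}\big)U}{1650\pi^2}\,\epsilon^{-1}\right\rfloor .$$ -/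

import Mathlib

noncomputable section

namespace DistOpt

/-- The space `ℝ^S` with its Euclidean norm. -/
abbrev Vec (S : ℕ) : Type := EuclideanSpace ℝ (Fin S)

/-! ### Problems -/

/-- `f(x) = (1/M) ∑ i, f_i(x_i)` for the concatenated variable `x = (x_1, …, x_M)`. -/
def avgObj {M S : ℕ} (f : Fin M → Vec S → ℝ) (x : Fin M → Vec S) : ℝ :=
  (1 / (M : ℝ)) * ∑ i, f i (x i)

/-- The problem class with uniform constant `U`: every `f_i` is differentiable, the smallest
Lipschitz constant of its gradient is `U`, and `f` is bounded below. -/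
structure InProblemClass {M S : ℕ} (U : ℝ) (f : Fin M → Vec S → ℝ) : Prop where
  differentiable : ∀ i, Differentiable ℝ (f i)
  lipschitz : ∀ i,
    IsLeast {L : ℝ | 0 ≤ L ∧ ∀ x z, ‖gradient (f i) x - gradient (f i) z‖ ≤ L * ‖x - z‖} U
  bddBelow : BddBelow (Set.range (avgObj f))

/-- `f(0) - inf f + ‖d₀‖² / (M U)`, where `d₀ = (∇f_1(0), …, ∇f_M(0))`. -/
def initialGap {M S : ℕ} (U : ℝ) (f : Fin M → Vec S → ℝ) : ℝ :=
  avgObj f 0 - (⨅ x, avgObj f x) + (∑ i, ‖gradient (f i) 0‖ ^ 2) / (M * U)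

/-! ### Networks -/

/-- Connected (unweighted, undirected) graphs on `M` nodes with diameter `D`. -/
structure InNetworkClass {M : ℕ} (D : ℕ) (G : SimpleGraph (Fin M)) : Prop where
  connected : G.Connected
  diam_eq : G.diam = D

open Classical in
/-- The degree of a node, as a real number. -/
def deg {M : ℕ} (G : SimpleGraph (Fin M)) (i : Fin M) : ℝ := (G.degree i : ℝ)

open Classical in
/-- The (normalized) graph Laplacian `𝓛`. -/
def laplacian {M : ℕ} (G : SimpleGraph (Fin M)) : Matrix (Fin M) (Fin M) ℝ :=
  Matrix.of fun i j =>
    if i = j then 1 else if G.Adj i j then -(1 / √(deg G i * deg G j)) else 0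

/-- `P^{1/2}`, where `P` is the diagonal matrix of degrees. -/
def sqrtDegree {M : ℕ} (G : SimpleGraph (Fin M)) : Matrix (Fin M) (Fin M) ℝ :=
  Matrix.diagonal fun i => √(deg G i)

/-- The smallest nonzero eigenvalue of a symmetric matrix. -/
def minNonzeroEigenvalue {M : ℕ} (B : Matrix (Fin M) (Fin M) ℝ) : ℝ :=
  sInf (spectrum ℝ B \ {0})

/-- The largest eigenvalue of a symmetric matrix. -/
def maxEigenvalue {M : ℕ} (B : Matrix (Fin M) (Fin M) ℝ) : ℝ :=
  sSup (spectrum ℝ B)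

/-- The spectral gap `ξ(G)`. -/
def spectralGap {M : ℕ} (G : SimpleGraph (Fin M)) : ℝ :=
  minNonzeroEigenvalue (laplacian G) / maxEigenvalue (laplacian G)

/-! ### Solution quality -/

open Classical in
/-- The quality of local variables `x = (x_1, …, x_M)`:
`‖(1/M) ∑ i, ∇f_i(x_i)‖² + U / (M λ) * ∑_{edges {i,j}} ‖x_i - x_j‖²`, where `λ` is the smallest
nonzero eigenvalue of `P^{1/2} 𝓛 P^{1/2}`; every edge is counted once. -/
def quality {M S : ℕ} (G : SimpleGraph (Fin M)) (U : ℝ) (f : Fin M → Vec S → ℝ)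
    (x : Fin M → Vec S) : ℝ :=
  ‖(1 / (M : ℝ)) • ∑ i, gradient (f i) (x i)‖ ^ 2 +
    U / (M * minNonzeroEigenvalue (sqrtDegree G * laplacian G * sqrtDegree G)) *
      ∑ i, ∑ j, if i < j ∧ G.Adj i j then ‖x i - x j‖ ^ 2 else 0

/-- `h*_t`, the minimum of the quality over the iterations `1, …, t` (used for `t ≥ 1`). -/
def hStar {M S : ℕ} (G : SimpleGraph (Fin M)) (U : ℝ) (f : Fin M → Vec S → ℝ)
    (x : ℕ → Fin M → Vec S) (t : ℕ) : ℝ :=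
  sInf ((fun s => quality G U f (x s)) '' Set.Icc 1 t)

/-! ### Algorithms -/

/-- An algorithm for `M` nodes, described by what it does: on every network `G` and every problem
`f` (of every dimension `S`) it produces iterates; `a G S f t i` is the iterate `x_i^t`. -/
def Algorithm (M : ℕ) : Type :=
  (G : SimpleGraph (Fin M)) → (S : ℕ) → (f : Fin M → Vec S → ℝ) → ℕ → Fin M → Vec S

/-- All nodes start from `x_i^0 = 0`. -/
def Algorithm.StartsAtZero {M : ℕ} (a : Algorithm M) : Prop :=
  ∀ (G : SimpleGraph (Fin M)) (S : ℕ) (f : Fin M → Vec S → ℝ) (i : Fin M), a G S f 0 i = 0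

/-- The linear operators of a distributed method, fixed before the problem is seen; they may depend
on the network and on the dimension.
* `Q G S t i` is `Q_i^t`, applied to `x_i^t` before it is broadcast.
* The operator `W_i^t` is given by its blocks: `Wmsg G S t i j k` acts on the message `v_j^k`,
  `Wgrad G S t i k` on `∇f_i(x_i^k)` and `Wself G S t i k` on `x_i^k`. -/
structure Operators (M : ℕ) where
  Q : SimpleGraph (Fin M) → (S : ℕ) → ℕ → Fin M → (Vec S →ₗ[ℝ] Vec S)
  Wmsg : SimpleGraph (Fin M) → (S : ℕ) → ℕ → Fin M → Fin M → ℕ → (Vec S →ₗ[ℝ] Vec S)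
  Wgrad : SimpleGraph (Fin M) → (S : ℕ) → ℕ → Fin M → ℕ → (Vec S →ₗ[ℝ] Vec S)
  Wself : SimpleGraph (Fin M) → (S : ℕ) → ℕ → Fin M → ℕ → (Vec S →ₗ[ℝ] Vec S)

/-- The class `𝒜`: `x_i^{t+1}` is a linear combination of the images, under the blocks of `W_i^t`,
of the messages `v_j^k = Q_j^k(x_j^k)` of the neighbours `j`, of the local gradients `∇f_i(x_i^k)`
and of the local iterates `x_i^k`, `k ≤ t`. The scalars are free. Taking all of them equal to `1`
gives `x_i^{t+1} = W_i^t(…)` for an arbitrary linear `W_i^t`; taking all blocks equal to the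
identity gives the linear span of the data. -/
def ClassA {M : ℕ} (a : Algorithm M) : Prop :=
  ∃ o : Operators M, ∀ (G : SimpleGraph (Fin M)) (S : ℕ) (f : Fin M → Vec S → ℝ),
    G.Connected → (∀ i, Differentiable ℝ (f i)) → ∀ (t : ℕ) (i : Fin M),
      a G S f (t + 1) i ∈ Submodule.span ℝ
        ({y | ∃ j k, G.Adj i j ∧ k ≤ t ∧ y = o.Wmsg G S t i j k (o.Q G S k j (a G S f k j))} ∪
         {y | ∃ k, k ≤ t ∧ y = o.Wgrad G S t i k (gradient (f i) (a G S f k i))} ∪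
         {y | ∃ k, k ≤ t ∧ y = o.Wself G S t i k (a G S f k i)})

/-- The linear operators of a method whose nodes see only the sums of their neighbours' messages:
`Wsum G S t i k` acts on `∑_{j ∼ i} v_j^k`; the others are as in `Operators`. -/
structure SumOperators (M : ℕ) where
  Q : SimpleGraph (Fin M) → (S : ℕ) → ℕ → Fin M → (Vec S →ₗ[ℝ] Vec S)
  Wsum : SimpleGraph (Fin M) → (S : ℕ) → ℕ → Fin M → ℕ → (Vec S →ₗ[ℝ] Vec S)
  Wgrad : SimpleGraph (Fin M) → (S : ℕ) → ℕ → Fin M → ℕ → (Vec S →ₗ[ℝ] Vec S)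
  Wself : SimpleGraph (Fin M) → (S : ℕ) → ℕ → Fin M → ℕ → (Vec S →ₗ[ℝ] Vec S)

open Classical in
/-- The class `𝒜'`: as `𝒜`, except that every node combines all its neighbours with the same
coefficients, that is, it uses only the sums `∑_{j ∼ i} v_j^k`. -/
def ClassA' {M : ℕ} (a : Algorithm M) : Prop :=
  ∃ o : SumOperators M, ∀ (G : SimpleGraph (Fin M)) (S : ℕ) (f : Fin M → Vec S → ℝ),
    G.Connected → (∀ i, Differentiable ℝ (f i)) → ∀ (t : ℕ) (i : Fin M),
      a G S f (t + 1) i ∈ Submodule.span ℝ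
        ({y | ∃ k, k ≤ t ∧
            y = o.Wsum G S t i k (∑ j ∈ G.neighborFinset i, o.Q G S k j (a G S f k j))} ∪
         {y | ∃ k, k ≤ t ∧ y = o.Wgrad G S t i k (gradient (f i) (a G S f k i))} ∪
         {y | ∃ k, k ≤ t ∧ y = o.Wself G S t i k (a G S f k i)})

end DistOpt

end

/-! The hard problem is a nonconvex chain whose directions can be discovered only one at a time,
with its links handed out so that consecutive links sit on opposite sides of the network.

Chain: `chainFun` couples consecutive coordinates, starting from a constant head. Both terms of each
link vanish to second order when its first variable is `0`, so from a point orthogonal to `u m, u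
(m+1), …` only an owner of link `m` can produce a new direction, and only `u m`
(`gradient_chainFun_mem_span`). While a chain coordinate is still `0`, the total gradient is bounded
below independently of the length of the chain (`le_norm_sum_gradient_chainFun`).

Delay: even links are owned by nodes of level at most `p`, odd ones by nodes of level at least `p +
δ`. An edge changes the level by at most one, so each further direction costs `δ + 1` rounds
(`mem_iterate_expand_of_lt_revealTime`). The operators may be arbitrary linear maps, but they are
fixed before the problem. In a large enough dimension each `u k` can therefore be chosen orthogonal
to everything that words in these operators make of the earlier directions
(`exists_adapted_unit_vectors`).

Quality: the consensus term bounds the spread of the local variables, so `quality` controls the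
average gradient at the mean point (`norm_sq_avg_gradient_le_quality`). The mean is orthogonal to
the last chain direction as long as all nodes are.

Scaling: a chain of `T + 1` links has initial gap of order `U * T` and gradient of order `U`.
Rescaling to gap `Δ` makes the squared gradient of order `U * Δ / T`, which is why `T` can be of
order `U * Δ / ε`.

Network: a double broom has a quarter of the nodes on each side at distance about `D / 3`, and a
spectral gap large enough that the second bound follows from the first (`exists_network`). -/

noncomputable section

namespace DistOpt

/-! ### Extreme eigenvalues of symmetric matrices -/

section Spectral

open Matrix

variable {M : ℕ} {B : Matrix (Fin M) (Fin M) ℝ}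

theorem exists_mulVec_eq_smul_of_mem_spectrum (hB : B.IsHermitian) {μ : ℝ}
    (hμ : μ ∈ spectrum ℝ B) : ∃ z : Fin M → ℝ, z ≠ 0 ∧ B *ᵥ z = μ • z := by
  rw [hB.spectrum_real_eq_range_eigenvalues] at hμ
  obtain ⟨i, rfl⟩ := hμ
  refine ⟨hB.eigenvectorBasis i, fun h => ?_, hB.mulVec_eigenvectorBasis i⟩
  have h1 := hB.eigenvectorBasis.orthonormal.ne_zero i
  apply h1
  ext j
  exact congrFun h j

theorem minNonzeroEigenvalue_mem (hB : B.IsHermitian) (h0 : B ≠ 0) :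
    minNonzeroEigenvalue B ∈ spectrum ℝ B \ {0} := by
  refine Set.Nonempty.csInf_mem ?_ (Matrix.finite_real_spectrum.subset Set.sdiff_subset)
  by_contra hne
  rw [Set.not_nonempty_iff_eq_empty] at hne
  apply h0
  rw [← hB.eigenvalues_eq_zero_iff]
  ext i
  by_contra hi
  have : hB.eigenvalues i ∈ spectrum ℝ B \ {0} := ⟨hB.eigenvalues_mem_spectrum_real i, hi⟩
  rw [hne] at this
  exact this

theorem minNonzeroEigenvalue_le {μ : ℝ} (hμ : μ ∈ spectrum ℝ B)
    (h0 : μ ≠ 0) : minNonzeroEigenvalue B ≤ μ :=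
  csInf_le (Matrix.finite_real_spectrum.subset Set.sdiff_subset).bddBelow ⟨hμ, h0⟩

theorem minNonzeroEigenvalue_pos (hB : B.PosSemidef) (h0 : B ≠ 0) :
    0 < minNonzeroEigenvalue B := by
  obtain ⟨h1, h2⟩ := minNonzeroEigenvalue_mem hB.isHermitian h0
  rw [hB.isHermitian.spectrum_real_eq_range_eigenvalues] at h1
  obtain ⟨i, hi⟩ := h1
  refine lt_of_le_of_ne ?_ (Ne.symm h2)
  rw [← hi]
  exact hB.eigenvalues_nonneg i

/-- The Rayleigh quotient on the orthogonal complement of the kernel. -/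
theorem minNonzeroEigenvalue_mul_dotProduct_le (hB : B.PosSemidef) (v : Fin M → ℝ)
    (hv : ∀ z, B *ᵥ z = 0 → z ⬝ᵥ v = 0) :
    minNonzeroEigenvalue B * (v ⬝ᵥ v) ≤ v ⬝ᵥ B *ᵥ v := by
  have hH := hB.isHermitian
  set b := hH.eigenvectorBasis
  have hin : ∀ x y : Fin M → ℝ, inner ℝ (WithLp.toLp 2 x) (WithLp.toLp 2 y) = x ⬝ᵥ y := by
    intro x y
    simp [EuclideanSpace.inner_eq_star_dotProduct, dotProduct_comm]
  have key : ∀ x y : Fin M → ℝ, x ⬝ᵥ y = ∑ i, (x ⬝ᵥ (b i).ofLp) * ((b i).ofLp ⬝ᵥ y) := by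
    intro x y
    rw [← hin, ← b.sum_inner_mul_inner]
    refine Finset.sum_congr rfl fun i _ => ?_
    rw [← hin, ← hin]
  have hBi : ∀ i, (b i).ofLp ⬝ᵥ B *ᵥ v = hH.eigenvalues i * ((b i).ofLp ⬝ᵥ v) := by
    intro i
    rw [dotProduct_mulVec, ← mulVec_transpose]
    have : Bᵀ = B := by simpa [IsHermitian, conjTranspose_eq_transpose_of_trivial] using hH
    rw [this, hH.mulVec_eigenvectorBasis i, smul_dotProduct, smul_eq_mul]
  rw [key v v, key v (B *ᵥ v), Finset.mul_sum]
  refine Finset.sum_le_sum fun i _ => ?_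
  rw [hBi, dotProduct_comm v]
  by_cases h0 : hH.eigenvalues i = 0
  · have : (b i).ofLp ⬝ᵥ v = 0 := hv _ (by rw [hH.mulVec_eigenvectorBasis i, h0, zero_smul])
    simp [this]
  · have := minNonzeroEigenvalue_le (hH.eigenvalues_mem_spectrum_real i) h0
    nlinarith [mul_self_nonneg ((b i).ofLp ⬝ᵥ v)]

end Spectral

/-! ### Normalized Laplacian, Dirichlet energy and spectral gap -/

section Laplacian

open Matrix

variable {M : ℕ} (G : SimpleGraph (Fin M))

/-- The Dirichlet energy: the sum of squared differences over the ordered adjacent pairs. -/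
def energy (g : Fin M → ℝ) : ℝ :=
  open Classical in ∑ i, ∑ j, if G.Adj i j then (g i - g j) ^ 2 else 0

variable {G}

theorem deg_pos (hG : G.Connected) (hM : 2 ≤ M) (i : Fin M) : 0 < deg G i := by
  classical
  have : Nontrivial (Fin M) := Fin.nontrivial_iff_two_le.mpr hM
  have := hG.preconnected.degree_pos_of_nontrivial i
  unfold deg
  exact_mod_cast (by convert this)

open Classical in
theorem sqrtDegree_mul_laplacian_mul_sqrtDegree (h : ∀ i, 0 < deg G i) :
    sqrtDegree G * laplacian G * sqrtDegree G = G.lapMatrix ℝ := by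
  ext i j
  rw [sqrtDegree, Matrix.mul_diagonal, Matrix.diagonal_mul, laplacian, Matrix.of_apply,
    SimpleGraph.lapMatrix, Matrix.sub_apply, SimpleGraph.degMatrix, SimpleGraph.adjMatrix_apply]
  rcases eq_or_ne i j with rfl | hij
  · simp only [if_true, mul_one, Matrix.diagonal_apply_eq, G.irrefl, if_false, sub_zero]
    exact Real.mul_self_sqrt (h i).le
  · rw [if_neg hij, Matrix.diagonal_apply_ne _ hij]
    split_ifs
    · have hi := Real.sqrt_pos.2 (h i)
      have hj := Real.sqrt_pos.2 (h j)
      rw [Real.sqrt_mul (h i).le]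
      field_simp
      simp
    · simp

theorem isHermitian_laplacian : (laplacian G).IsHermitian := by
  ext i j
  simp only [laplacian, conjTranspose_apply, of_apply, star_trivial]
  rcases eq_or_ne i j with rfl | hij
  · simp
  · rw [if_neg hij, if_neg hij.symm, G.adj_comm, mul_comm]

open Classical in
theorem dotProduct_lapMatrix_mulVec (g : Fin M → ℝ) :
    g ⬝ᵥ (G.lapMatrix ℝ) *ᵥ g = energy G g / 2 := by
  rw [← Matrix.toLinearMap₂'_apply', SimpleGraph.lapMatrix_toLinearMap₂', energy]

/-- Eigenvectors of the normalized Laplacian in the degree-weighted form. -/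
theorem exists_energy_eq_of_mem_spectrum (hd : ∀ i, 0 < deg G i) {μ : ℝ}
    (hμ : μ ∈ spectrum ℝ (laplacian G)) :
    ∃ g : Fin M → ℝ, 0 < ∑ i, deg G i * g i ^ 2 ∧
      energy G g = 2 * μ * ∑ i, deg G i * g i ^ 2 ∧ μ * ∑ i, deg G i * g i = 0 := by
  classical
  obtain ⟨z, hz, hzμ⟩ := exists_mulVec_eq_smul_of_mem_spectrum isHermitian_laplacian hμ
  have hs : ∀ i, 0 < √(deg G i) := fun i => Real.sqrt_pos.2 (hd i)
  set g : Fin M → ℝ := fun i => z i / √(deg G i) with hg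
  have hSg : sqrtDegree G *ᵥ g = z := by
    ext i
    rw [sqrtDegree, mulVec_diagonal, hg]
    exact mul_div_cancel₀ _ (hs i).ne'
  have hL : ∀ i, (G.lapMatrix ℝ *ᵥ g) i = μ * (deg G i * g i) := by
    intro i
    rw [← sqrtDegree_mul_laplacian_mul_sqrtDegree hd, ← mulVec_mulVec, ← mulVec_mulVec, hSg, hzμ,
      sqrtDegree, mulVec_diagonal, Pi.smul_apply, smul_eq_mul]
    have : z i = √(deg G i) * g i := (mul_div_cancel₀ _ (hs i).ne').symm
    rw [this]
    linear_combination μ * g i * Real.mul_self_sqrt (hd i).le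
  refine ⟨g, ?_, ?_, ?_⟩
  · obtain ⟨i, hi⟩ := Function.ne_iff.1 hz
    refine Finset.sum_pos' (fun j _ => mul_nonneg (hd j).le (sq_nonneg _)) ⟨i, Finset.mem_univ _, ?_⟩
    have : g i ≠ 0 := div_ne_zero hi (hs i).ne'
    have := hd i
    positivity
  · have := dotProduct_lapMatrix_mulVec (G := G) g
    rw [eq_div_iff two_ne_zero] at this
    rw [← this, dotProduct, Finset.mul_sum, Finset.sum_mul]
    refine Finset.sum_congr rfl fun i _ => ?_
    rw [hL]; ring
  · have h1 : (fun _ => (1 : ℝ)) ⬝ᵥ (G.lapMatrix ℝ *ᵥ g) = 0 := by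
      rw [dotProduct_mulVec, ← mulVec_transpose, (G.isSymm_lapMatrix ℝ).eq,
        G.lapMatrix_mulVec_const_eq_zero, zero_dotProduct]
    rw [← h1, dotProduct, Finset.mul_sum]
    exact Finset.sum_congr rfl fun i _ => by rw [hL, one_mul]

open Classical in
theorem deg_eq_sum (i : Fin M) : deg G i = ∑ j, if G.Adj i j then (1 : ℝ) else 0 :=
  G.degree_eq_sum_if_adj i

/-- From `(a - b)² ≤ 2a² + 2b²` on every ordered edge. It yields the bound `2` on the largest
eigenvalue. -/
theorem energy_le (g : Fin M → ℝ) : energy G g ≤ 4 * ∑ i, deg G i * g i ^ 2 := by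
  classical
  have h1 : energy G g ≤ ∑ i, ∑ j, ((if G.Adj i j then (1 : ℝ) else 0) * (2 * g i ^ 2) +
      (if G.Adj i j then (1 : ℝ) else 0) * (2 * g j ^ 2)) := by
    refine Finset.sum_le_sum fun i _ => Finset.sum_le_sum fun j _ => ?_
    split_ifs
    · nlinarith [sq_nonneg (g i + g j)]
    · simp
  have h2 : ∀ j, ∑ i, (if G.Adj i j then (1 : ℝ) else 0) = deg G j := fun j => by
    simp_rw [deg_eq_sum, G.adj_comm j]
  refine h1.trans (le_of_eq ?_)
  simp_rw [Finset.sum_add_distrib]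
  rw [Finset.sum_comm (f := fun i j => (if G.Adj i j then (1 : ℝ) else 0) * (2 * g j ^ 2))]
  simp_rw [← Finset.sum_mul, h2, ← deg_eq_sum]
  rw [← Finset.sum_add_distrib, Finset.mul_sum]
  exact Finset.sum_congr rfl fun i _ => by ring

/-- A Poincaré inequality around one vertex bounds the spectral gap from below. -/
theorem le_spectralGap (hd : ∀ i, 0 < deg G i) (c : Fin M) {K : ℝ} (hK : 0 < K)
    (hP : ∀ g : Fin M → ℝ, ∑ i, deg G i * (g i - g c) ^ 2 ≤ K * energy G g) :
    1 / (4 * K) ≤ spectralGap G := by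
  have hH : (laplacian G).IsHermitian := isHermitian_laplacian
  have h0 : laplacian G ≠ 0 := by
    intro h
    have := congrFun (congrFun h c) c
    simp [laplacian] at this
  have hlow : ∀ μ ∈ spectrum ℝ (laplacian G), μ ≠ 0 → 1 / (2 * K) ≤ μ := by
    intro μ hμ hμ0
    obtain ⟨g, hpos, hE, hs⟩ := exists_energy_eq_of_mem_spectrum hd hμ
    have hs' : ∑ i, deg G i * g i = 0 := (mul_eq_zero.1 hs).resolve_left hμ0
    -- The degree-weighted mean of `g` is zero, so recentring at `g c` can only increase the
    -- weighted sum of squares.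
    have h1 : ∑ i, deg G i * g i ^ 2 ≤ ∑ i, deg G i * (g i - g c) ^ 2 := by
      have : ∑ i, deg G i * (g i - g c) ^ 2 = ∑ i, deg G i * g i ^ 2
          - 2 * g c * ∑ i, deg G i * g i + ∑ i, deg G i * g c ^ 2 := by
        rw [Finset.mul_sum, ← Finset.sum_sub_distrib, ← Finset.sum_add_distrib]
        exact Finset.sum_congr rfl fun i _ => by ring
      rw [this, hs']
      have : 0 ≤ ∑ i, deg G i * g c ^ 2 :=
        Finset.sum_nonneg fun i _ => mul_nonneg (hd i).le (sq_nonneg _)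
      linarith
    have h2 := hP g
    rw [hE] at h2
    rw [div_le_iff₀ (by positivity)]
    by_contra hlt
    push Not at hlt
    nlinarith
  have hmin := hlow _ (minNonzeroEigenvalue_mem hH h0).1 (minNonzeroEigenvalue_mem hH h0).2
  have hmax : maxEigenvalue (laplacian G) ≤ 2 := by
    refine Real.sSup_le (fun μ hμ => ?_) (by norm_num)
    obtain ⟨g, hpos, hE, -⟩ := exists_energy_eq_of_mem_spectrum hd hμ
    have := energy_le (G := G) g
    rw [hE] at this
    by_contra hlt
    push Not at hlt
    nlinarith
  have hle : minNonzeroEigenvalue (laplacian G) ≤ maxEigenvalue (laplacian G) :=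
    le_csSup Matrix.finite_real_spectrum.bddAbove (minNonzeroEigenvalue_mem hH h0).1
  have hK' : 0 < 1 / (2 * K) := by positivity
  rw [spectralGap, le_div_iff₀ (by linarith)]
  calc 1 / (4 * K) * maxEigenvalue (laplacian G) ≤ 1 / (4 * K) * 2 := by gcongr
    _ = 1 / (2 * K) := by field_simp; norm_num
    _ ≤ _ := hmin

end Laplacian

/-! ### From the consensus penalty to the gradient at the mean point -/

section Consensus

open Matrix

variable {M S : ℕ} {G : SimpleGraph (Fin M)}

theorem energy_eq_two_mul (g : Fin M → Fin M → ℝ) (hg : ∀ i j, g i j = g j i) :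
    open Classical in (∑ i, ∑ j, if G.Adj i j then g i j else 0) =
      2 * ∑ i, ∑ j, if i < j ∧ G.Adj i j then g i j else 0 := by
  classical
  have h : ∀ i j, (if G.Adj i j then g i j else 0) =
      (if i < j ∧ G.Adj i j then g i j else 0) + (if j < i ∧ G.Adj j i then g j i else 0) := by
    intro i j
    rw [G.adj_comm j i, hg j i]
    rcases lt_trichotomy i j with h | rfl | h
    · simp [h, h.not_gt]
    · simp
    · simp [h, h.not_gt]
  simp_rw [h, Finset.sum_add_distrib]
  rw [Finset.sum_comm (f := fun i j => if j < i ∧ G.Adj j i then g j i else 0), two_mul]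

/-- The Laplacian controls the distance to the average. -/
theorem minNonzeroEigenvalue_mul_sum_norm_sq_le (hG : G.Connected) (hM : 2 ≤ M)
    (x : Fin M → Vec S) :
    open Classical in
    minNonzeroEigenvalue (sqrtDegree G * laplacian G * sqrtDegree G) *
      ∑ i, ‖x i - (1 / (M : ℝ)) • ∑ j, x j‖ ^ 2 ≤
      ∑ i, ∑ j, if i < j ∧ G.Adj i j then ‖x i - x j‖ ^ 2 else 0 := by
  classical
  rw [sqrtDegree_mul_laplacian_mul_sqrtDegree (deg_pos hG hM)]
  have hM0 : (M : ℝ) ≠ 0 := by positivity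
  set xb := (1 / (M : ℝ)) • ∑ j, x j with hxb
  have hcoord : ∀ s : Fin S, minNonzeroEigenvalue (G.lapMatrix ℝ) * ∑ i, (x i s - xb s) ^ 2 ≤
      ∑ i, ∑ j, if i < j ∧ G.Adj i j then (x i s - x j s) ^ 2 else 0 := by
    intro s
    -- On a connected graph the kernel consists of the constants, to which the deviations from the
    -- mean are orthogonal.
    have h := minNonzeroEigenvalue_mul_dotProduct_le (G.posSemidef_lapMatrix ℝ)
      (fun i => x i s - xb s) (by
        intro z hz
        rw [SimpleGraph.lapMatrix_mulVec_eq_zero_iff_forall_reachable] at hz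
        have hc : ∀ i, z i = z ⟨0, by omega⟩ := fun i => hz _ _ (hG.preconnected _ _)
        rw [dotProduct]
        simp_rw [fun i => hc i]
        rw [← Finset.mul_sum, Finset.sum_sub_distrib, hxb]
        simp
        right
        field_simp
        simp)
    rw [dotProduct_lapMatrix_mulVec, energy, energy_eq_two_mul _ (fun i j => by ring)] at h
    simp only [sub_sub_sub_cancel_right] at h
    rw [mul_div_cancel_left₀ _ (two_ne_zero)] at h
    simpa [dotProduct, sq] using h
  have hn : ∀ v : Vec S, ‖v‖ ^ 2 = ∑ s, v s ^ 2 := fun v => by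
    rw [EuclideanSpace.norm_sq_eq]; simp
  calc _ = ∑ s, minNonzeroEigenvalue (G.lapMatrix ℝ) * ∑ i, (x i s - xb s) ^ 2 := by
        rw [← Finset.mul_sum, Finset.sum_comm]
        simp [hn]
    _ ≤ ∑ s, ∑ i, ∑ j, if i < j ∧ G.Adj i j then (x i s - x j s) ^ 2 else 0 :=
        Finset.sum_le_sum fun s _ => hcoord s
    _ = _ := by
        rw [Finset.sum_comm]
        refine Finset.sum_congr rfl fun i _ => ?_
        rw [Finset.sum_comm]
        refine Finset.sum_congr rfl fun j _ => ?_
        split_ifs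
        · simp [hn]
        · simp

theorem lapMatrix_ne_zero (hG : G.Connected) (hM : 2 ≤ M) :
    open Classical in G.lapMatrix ℝ ≠ 0 := by
  classical
  intro h
  have h1 := congrFun (congrFun h ⟨0, by omega⟩) ⟨0, by omega⟩
  have h2 := deg_pos hG hM ⟨0, by omega⟩
  simp only [SimpleGraph.lapMatrix, SimpleGraph.degMatrix, Matrix.sub_apply, diagonal_apply_eq,
    SimpleGraph.adjMatrix_apply, G.irrefl, if_false, sub_zero, Matrix.zero_apply] at h1
  exact h2.ne' h1

/-- The quality measure controls the gradient of the average at the averaged point. -/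
theorem norm_sq_avg_gradient_le_quality (hG : G.Connected) (hM : 2 ≤ M) {U : ℝ} (hU0 : 0 < U)
    (hU1 : U < 1) (f : Fin M → Vec S → ℝ)
    (hf : ∀ i x z, ‖gradient (f i) x - gradient (f i) z‖ ≤ U * ‖x - z‖) (x : Fin M → Vec S) :
    ‖(1 / (M : ℝ)) • ∑ i, gradient (f i) ((1 / (M : ℝ)) • ∑ j, x j)‖ ^ 2 ≤
      2 * quality G U f x := by
  classical
  set xb := (1 / (M : ℝ)) • ∑ j, x j with hxb
  have hMpos : (0 : ℝ) < M := by positivity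
  set lam := minNonzeroEigenvalue (sqrtDegree G * laplacian G * sqrtDegree G) with hlam
  have hpos : 0 < lam := by
    rw [hlam, sqrtDegree_mul_laplacian_mul_sqrtDegree (deg_pos hG hM)]
    exact minNonzeroEigenvalue_pos (G.posSemidef_lapMatrix ℝ) (lapMatrix_ne_zero hG hM)
  have hE := minNonzeroEigenvalue_mul_sum_norm_sq_le (S := S) hG hM x
  rw [← hlam, ← hxb] at hE
  set E := ∑ i, ∑ j, if i < j ∧ G.Adj i j then ‖x i - x j‖ ^ 2 else 0
  set V := ∑ i, ‖x i - xb‖ ^ 2 with hV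
  set a := (1 / (M : ℝ)) • ∑ i, gradient (f i) (x i) with ha
  set b := (1 / (M : ℝ)) • ∑ i, gradient (f i) xb with hb
  have hq : quality G U f x = ‖a‖ ^ 2 + U / (M * lam) * E := rfl
  have h1 : U / M * V ≤ U / (M * lam) * E := by
    have : U / M * V = U / (M * lam) * (lam * V) := by field_simp
    rw [this]
    gcongr
  have hd : ‖b - a‖ ≤ (1 / M) * ∑ i, U * ‖x i - xb‖ := by
    rw [hb, ha, ← smul_sub, ← Finset.sum_sub_distrib, norm_smul, Real.norm_of_nonneg (by positivity)]
    gcongr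
    refine (norm_sum_le _ _).trans (Finset.sum_le_sum fun i _ => ?_)
    rw [norm_sub_rev]
    exact hf i _ _
  have hcs : (∑ i, ‖x i - xb‖) ^ 2 ≤ M * V := by
    have := sq_sum_le_card_mul_sum_sq (s := Finset.univ) (f := fun i => ‖x i - xb‖)
    simpa using this
  -- Lipschitz gradients and Cauchy–Schwarz give the factor `U² / M`; `U < 1` lowers `U²` to the `U`
  -- that appears in the quality.
  have h2 : ‖b - a‖ ^ 2 ≤ U / M * V := by
    rw [← Finset.mul_sum] at hd
    calc ‖b - a‖ ^ 2 ≤ ((1 / M) * (U * ∑ i, ‖x i - xb‖)) ^ 2 := by gcongr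
      _ = (U / M) ^ 2 * (∑ i, ‖x i - xb‖) ^ 2 := by ring
      _ ≤ (U / M) ^ 2 * (M * V) := by gcongr
      _ = U * (U / M * V) := by field_simp
      _ ≤ 1 * (U / M * V) := by gcongr
      _ = _ := one_mul _
  have h3 : ‖b‖ ≤ ‖a‖ + ‖b - a‖ := by
    have := norm_add_le a (b - a)
    simpa using this
  rw [hq]
  nlinarith [norm_nonneg a, norm_nonneg b, norm_nonneg (b - a), sq_nonneg (‖a‖ - ‖b - a‖)]

end Consensus

/-! ### The double broom: diameter, edge count and spectral gap -/

section Broom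

variable {M D : ℕ}

/-- The level of a node of the double broom: a path of length `D` whose two ends are replicated. -/
def broomLevel (M D : ℕ) (i : Fin M) : ℕ := min (i.val - (M - D - 1) / 2) D

/-- The double broom: nodes are adjacent when their levels are consecutive. -/
def broom (M D : ℕ) : SimpleGraph (Fin M) where
  Adj i j := broomLevel M D j = broomLevel M D i + 1 ∨ broomLevel M D i = broomLevel M D j + 1
  symm := ⟨fun _ _ h => h.symm⟩
  loopless := ⟨fun _ h => by rcases h with h | h <;> omega⟩

/-- A node of level `k` (for `k ≤ D`). -/
def broomNode (hDM : D + 1 ≤ M) (k : ℕ) : Fin M :=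
  ⟨min ((M - D - 1) / 2 + k) (M - 1), by omega⟩

theorem broomLevel_node (hDM : D + 1 ≤ M) {k : ℕ} (hk : k ≤ D) :
    broomLevel M D (broomNode hDM k) = k := by
  simp only [broomLevel, broomNode]
  omega

theorem broomLevel_le (i : Fin M) : broomLevel M D i ≤ D := min_le_right _ _

theorem eq_of_broomLevel_eq {i j : Fin M} (h : broomLevel M D i = broomLevel M D j)
    (h0 : 0 < broomLevel M D i) (h1 : broomLevel M D i < D) : i = j := by
  simp only [broomLevel] at *
  ext
  omega

theorem edist_le_of_broomLevel_lt (hDM : D + 1 ≤ M) (n : ℕ) : ∀ {i j : Fin M},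
    broomLevel M D j = broomLevel M D i + n + 1 → (broom M D).edist i j ≤ (n + 1 : ℕ) := by
  induction n with
  | zero =>
    intro i j h
    have : (broom M D).Adj i j := Or.inl h
    rw [SimpleGraph.edist_eq_one_iff_adj.2 this]
    norm_num
  | succ n ih =>
    intro i j h
    have hj := broomLevel_le (D := D) j
    have hk := broomLevel_node (k := broomLevel M D i + n + 1) hDM (by omega)
    have hadj : (broom M D).Adj (broomNode hDM (broomLevel M D i + n + 1)) j :=
      Or.inl (by rw [hk]; omega)
    refine (SimpleGraph.edist_triangle (v := broomNode hDM (broomLevel M D i + n + 1))).trans ?_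
    rw [SimpleGraph.edist_eq_one_iff_adj.2 hadj]
    calc _ ≤ ((n + 1 : ℕ) : ℕ∞) + 1 := by gcongr; exact ih hk
      _ = _ := by push_cast; rfl

theorem edist_broom_le (hD : 2 ≤ D) (hDM : D + 1 ≤ M) (i j : Fin M) :
    (broom M D).edist i j ≤ D := by
  have hi := broomLevel_le (D := D) i
  have hj := broomLevel_le (D := D) j
  have key : ∀ {i j : Fin M}, broomLevel M D i < broomLevel M D j →
      (broom M D).edist i j ≤ D := by
    intro i j h
    have hj := broomLevel_le (D := D) j
    refine (edist_le_of_broomLevel_lt hDM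
      (broomLevel M D j - broomLevel M D i - 1) (by omega)).trans ?_
    exact_mod_cast (by omega)
  rcases lt_trichotomy (broomLevel M D i) (broomLevel M D j) with h | h | h
  · exact key h
  -- Nodes of equal level share a neighbour, hence are at distance at most `2`; this is where `D ≥
  -- 2` enters.
  · obtain ⟨v, hv1, hv2⟩ : ∃ v, (broom M D).Adj i v ∧ (broom M D).Adj v j := by
      rcases Nat.eq_zero_or_pos (broomLevel M D i) with h0 | h0
      · refine ⟨broomNode hDM 1, Or.inl ?_, Or.inr ?_⟩ <;>
          rw [broomLevel_node hDM (by omega)] <;> omega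
      · refine ⟨broomNode hDM (broomLevel M D i - 1), Or.inr ?_, Or.inl ?_⟩ <;>
          rw [broomLevel_node hDM (by omega)] <;> omega
    refine (SimpleGraph.edist_triangle (v := v)).trans ?_
    rw [SimpleGraph.edist_eq_one_iff_adj.2 hv1, SimpleGraph.edist_eq_one_iff_adj.2 hv2]
    exact_mod_cast hD
  · rw [SimpleGraph.edist_comm]
    exact key h

theorem broomLevel_le_add_length {i j : Fin M} (w : (broom M D).Walk i j) :
    broomLevel M D j ≤ broomLevel M D i + w.length := by
  induction w with
  | nil => simp
  | cons h w ih =>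
    rw [SimpleGraph.Walk.length_cons]
    rcases h with h | h <;> omega

theorem broom_inNetworkClass (hD : 2 ≤ D) (hDM : D + 1 ≤ M) : InNetworkClass D (broom M D) := by
  have : Nonempty (Fin M) := ⟨⟨0, by omega⟩⟩
  have hed : (broom M D).ediam ≤ D := SimpleGraph.ediam_le_of_edist_le (edist_broom_le hD hDM)
  have hne : (broom M D).ediam ≠ ⊤ := ne_top_of_le_ne_top (ENat.natCast_ne_top D) hed
  have hconn := SimpleGraph.connected_of_ediam_ne_top hne
  refine ⟨hconn, le_antisymm ?_ ?_⟩
  · have := ENat.toNat_le_toNat hed (ENat.natCast_ne_top D)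
    rwa [ENat.toNat_natCast] at this
  · obtain ⟨w, hw⟩ := hconn.exists_walk_length_eq_dist (broomNode hDM 0) (broomNode hDM D)
    have h1 := broomLevel_le_add_length w
    rw [broomLevel_node hDM (Nat.zero_le D), broomLevel_node hDM le_rfl, hw] at h1
    have := SimpleGraph.dist_le_diam hne (u := broomNode hDM 0) (v := broomNode hDM D)
    omega

theorem energy_broom (g : Fin M → ℝ) : energy (broom M D) g =
    2 * ∑ x : Fin M × Fin M,
      if broomLevel M D x.2 = broomLevel M D x.1 + 1 then (g x.1 - g x.2) ^ 2 else 0 := by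
  classical
  have h : ∀ i j, (if (broom M D).Adj i j then (g i - g j) ^ 2 else 0) =
      (if broomLevel M D j = broomLevel M D i + 1 then (g i - g j) ^ 2 else 0) +
      (if broomLevel M D i = broomLevel M D j + 1 then (g j - g i) ^ 2 else 0) := by
    intro i j
    by_cases h1 : broomLevel M D j = broomLevel M D i + 1
    · simp only [broom, h1, true_or, if_true]
      rw [if_neg (by omega), add_zero]
    · by_cases h2 : broomLevel M D i = broomLevel M D j + 1
      · simp only [broom, h2, or_true, if_true]
        rw [if_neg (by omega), zero_add, sub_sq_comm]
      · simp [broom, h1, h2]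
  rw [energy, Fintype.sum_prod_type]
  simp_rw [h, Finset.sum_add_distrib]
  rw [Finset.sum_comm (f := fun i j => if broomLevel M D i = broomLevel M D j + 1
    then (g j - g i) ^ 2 else 0), two_mul]

/-- For `D ≥ 2` the broom is a tree. Charging each edge to its end away from the interior (the lower
end if that has level `0`, the upper end otherwise) is injective, so there are at most `M` edges. -/
theorem sum_deg_broom_le (hD : 2 ≤ D) : ∑ i, deg (broom M D) i ≤ 2 * M := by
  classical
  have h : ∀ i j, (if (broom M D).Adj i j then (1 : ℝ) else 0) =
      (if broomLevel M D j = broomLevel M D i + 1 then 1 else 0) +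
      (if broomLevel M D i = broomLevel M D j + 1 then 1 else 0) := by
    intro i j
    by_cases h1 : broomLevel M D j = broomLevel M D i + 1
    · simp only [broom, h1, true_or, if_true]
      rw [if_neg (by omega), add_zero]
    · by_cases h2 : broomLevel M D i = broomLevel M D j + 1
      · simp only [broom, h2, or_true, if_true]
        rw [if_neg (by omega), zero_add]
      · simp [broom, h1, h2]
  simp_rw [deg_eq_sum, h, Finset.sum_add_distrib]
  rw [Finset.sum_comm (f := fun i j => if broomLevel M D i = broomLevel M D j + 1
    then (1 : ℝ) else 0), ← two_mul, ← Fintype.sum_prod_type'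
    (f := fun i j => if broomLevel M D j = broomLevel M D i + 1 then (1 : ℝ) else 0),
    Finset.sum_boole]
  have hc : (Finset.univ.filter fun x : Fin M × Fin M =>
      broomLevel M D x.2 = broomLevel M D x.1 + 1).card ≤ (Finset.univ : Finset (Fin M)).card := by
    refine Finset.card_le_card_of_injOn
      (fun x => if broomLevel M D x.1 = 0 then x.1 else x.2) (fun _ _ => Finset.mem_univ _) ?_
    rintro ⟨i, j⟩ hij ⟨i', j'⟩ hij' h
    simp only [Finset.coe_filter, Finset.mem_univ, true_and, Set.mem_ofPred_eq] at hij hij' h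
    have h1 := broomLevel_le (D := D) j
    have h2 := broomLevel_le (D := D) j'
    split_ifs at h with h3 h4 h4
    · subst h
      rw [eq_of_broomLevel_eq (hij.trans hij'.symm) (by omega) (by omega)]
    · subst h; omega
    · subst h; omega
    · subst h
      rw [eq_of_broomLevel_eq (D := D) (i := i) (j := i') (by omega) (by omega) (by omega)]
  rw [Finset.card_univ, Fintype.card_fin] at hc
  gcongr

/-- Along a path of increasing level the energy controls the total difference. -/
theorem sq_sub_le_energy_broom (g : Fin M → ℝ) (q : ℕ → Fin M) (a n : ℕ)
    (hq : ∀ k ≤ n, broomLevel M D (q k) = a + k) :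
    (g (q n) - g (q 0)) ^ 2 ≤ n * (energy (broom M D) g / 2) := by
  classical
  rw [energy_broom, mul_div_cancel_left₀ _ two_ne_zero,
    ← Finset.sum_range_sub (fun k => g (q k))]
  refine sq_sum_le_card_mul_sum_sq.trans ?_
  rw [Finset.card_range]
  gcongr
  have hinj : Set.InjOn (fun k => (q k, q (k + 1))) (Finset.range n : Set ℕ) := by
    intro k hk l hl h
    simp only [Finset.coe_range, Set.mem_Iio, Prod.mk.injEq] at hk hl h
    have h1 := hq k (by omega)
    have h2 := hq l (by omega)
    rw [h.1] at h1
    omega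
  calc _ = ∑ k ∈ Finset.range n, (fun x : Fin M × Fin M =>
        if broomLevel M D x.2 = broomLevel M D x.1 + 1 then (g x.1 - g x.2) ^ 2 else 0)
          (q k, q (k + 1)) := by
        refine Finset.sum_congr rfl fun k hk => ?_
        rw [Finset.mem_range] at hk
        have h1 := hq k (by omega)
        have h2 := hq (k + 1) (by omega)
        simp only
        rw [if_pos (by omega)]
        ring
    _ = ∑ x ∈ (Finset.range n).image (fun k => (q k, q (k + 1))),
        if broomLevel M D x.2 = broomLevel M D x.1 + 1 then (g x.1 - g x.2) ^ 2 else 0 :=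
        (Finset.sum_image (f := fun x : Fin M × Fin M =>
          if broomLevel M D x.2 = broomLevel M D x.1 + 1 then (g x.1 - g x.2) ^ 2 else 0) hinj).symm
    _ ≤ _ := by
        refine Finset.sum_le_sum_of_subset_of_nonneg (Finset.subset_univ _) fun x _ _ => ?_
        split_ifs <;> positivity

theorem energy_nonneg {G : SimpleGraph (Fin M)} (g : Fin M → ℝ) : 0 ≤ energy G g :=
  Finset.sum_nonneg fun _ _ => Finset.sum_nonneg fun _ _ => by split_ifs <;> positivity

theorem spectralGap_nonneg {G : SimpleGraph (Fin M)} (hd : ∀ i, 0 < deg G i) :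
    0 ≤ spectralGap G := by
  have h : ∀ μ ∈ spectrum ℝ (laplacian G), 0 ≤ μ := by
    intro μ hμ
    obtain ⟨g, hpos, hE, -⟩ := exists_energy_eq_of_mem_spectrum hd hμ
    have := energy_nonneg (G := G) g
    rw [hE] at this
    exact (mul_nonneg_iff_of_pos_left two_pos).1 (nonneg_of_mul_nonneg_left this hpos)
  exact div_nonneg (Real.sInf_nonneg fun μ hμ => h μ hμ.1) (Real.sSup_nonneg h)

/-- A path of monotone level joins every node to the centre in at most `D - D / 2` steps;
Cauchy–Schwarz along it does the rest. -/
theorem sq_sub_center_le (hD : 2 ≤ D) (hDM : D + 1 ≤ M) (g : Fin M → ℝ) (i : Fin M) :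
    (g i - g (broomNode hDM (D / 2))) ^ 2 ≤
      ((D - D / 2 : ℕ) : ℝ) * (energy (broom M D) g / 2) := by
  have hE := energy_nonneg (G := broom M D) g
  have hi := broomLevel_le (D := D) i
  have hc := broomLevel_node hDM (k := D / 2) (by omega)
  rcases lt_trichotomy (broomLevel M D i) (D / 2) with h | h | h
  · have := sq_sub_le_energy_broom (D := D) g
      (fun k => if k = 0 then i else broomNode hDM (broomLevel M D i + k))
      (broomLevel M D i) (D / 2 - broomLevel M D i) (by
        intro k hk
        rcases Nat.eq_zero_or_pos k with rfl | h0
        · simp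
        · simp only [h0.ne', if_false]
          exact broomLevel_node hDM (by omega))
    rw [if_neg (by omega), if_pos rfl, ← neg_sq, neg_sub, Nat.add_sub_cancel' h.le] at this
    exact this.trans (mul_le_mul_of_nonneg_right (by exact_mod_cast (by omega)) (by linarith))
  · rw [eq_of_broomLevel_eq (h.trans hc.symm) (by omega) (by omega), sub_self, sq, mul_zero]
    exact mul_nonneg (Nat.cast_nonneg _) (by linarith)
  · have := sq_sub_le_energy_broom (D := D) g
      (fun k => if k = broomLevel M D i - D / 2 then i else broomNode hDM (D / 2 + k))
      (D / 2) (broomLevel M D i - D / 2) (by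
        intro k hk
        by_cases h0 : k = broomLevel M D i - D / 2
        · simp only [h0, if_true]; omega
        · simp only [h0, if_false]
          exact broomLevel_node hDM (by omega))
    rw [if_pos rfl, if_neg (by omega), Nat.add_zero] at this
    refine this.trans ?_
    gcongr

theorem le_spectralGap_broom (hD : 2 ≤ D) (hDM : D + 1 ≤ M) :
    ((D : ℝ) - 1) / (2 * M) ≤ D ^ 2 * spectralGap (broom M D) := by
  have hMpos : (0 : ℝ) < M := by exact_mod_cast (by omega : 0 < M)
  have hr : 0 < D - D / 2 := by omega
  have hr2 : 2 * ((D - D / 2 : ℕ) : ℝ) ≤ D + 1 := by exact_mod_cast (by omega)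
  set r : ℝ := ((D - D / 2 : ℕ) : ℝ) with hrdef
  have hrpos : 0 < r := Nat.cast_pos.2 hr
  have hd := fun i => deg_pos (broom_inNetworkClass hD hDM).connected (by omega) i
  have h := le_spectralGap (G := broom M D) hd (broomNode hDM (D / 2)) (K := M * r)
    (by positivity) (by
      intro g
      have hE := energy_nonneg (G := broom M D) g
      calc _ ≤ ∑ i, deg (broom M D) i * (r * (energy (broom M D) g / 2)) :=
            Finset.sum_le_sum fun i _ =>
              mul_le_mul_of_nonneg_left (sq_sub_center_le hD hDM g i) (hd i).le
        _ = (∑ i, deg (broom M D) i) * (r * (energy (broom M D) g / 2)) := by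
            rw [Finset.sum_mul]
        _ ≤ (2 * M) * (r * (energy (broom M D) g / 2)) := by
            gcongr
            exact sum_deg_broom_le hD
        _ = _ := by ring)
  have hD1 : (2 : ℝ) ≤ D := by exact_mod_cast hD
  -- Since `2r ≤ D + 1`, this reduces to `(D - 1)(D + 1) ≤ D²`.
  calc ((D : ℝ) - 1) / (2 * M) ≤ D ^ 2 * (1 / (4 * (M * r))) := by
        rw [mul_one_div, div_le_div_iff₀ (by positivity) (by positivity)]
        nlinarith [mul_pos hMpos hrpos, mul_le_mul_of_nonneg_left hr2
          (by nlinarith : (0 : ℝ) ≤ M * (D - 1))]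
    _ ≤ _ := by gcongr

end Broom

/-! ### The network with two large, distant groups -/

theorem le_card_of_forall_lt {n : ℕ} (s : Finset (Fin M)) (a : ℕ) (ha : a + n ≤ M)
    (h : ∀ i : Fin M, a ≤ i.val → i.val < a + n → i ∈ s) : n ≤ s.card := by
  have := Finset.card_le_card_of_injOn (s := (Finset.univ : Finset (Fin n))) (t := s)
    (fun k => ⟨a + k, by omega⟩) (fun k _ => h _ (by simp) (by simp))
    (fun k _ l _ hkl => by simpa [Fin.ext_iff] using hkl)
  simpa using this

/-- A network of diameter `D` with two far apart groups, each of a quarter of the nodes, and with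
a large spectral gap. -/
theorem exists_network (M D : ℕ) (hD : 1 ≤ D) (hDM : D + 1 ≤ M) :
    ∃ (G : SimpleGraph (Fin M)) (lev : Fin M → ℕ) (p δ : ℕ), InNetworkClass D G ∧
      (∀ i j, G.Adj i j → lev i ≤ lev j + 1) ∧ 1 ≤ δ ∧ D ≤ 3 * (δ + 1) ∧
      M ≤ 4 * (Finset.univ.filter fun i => lev i ≤ p).card ∧
      M ≤ 4 * (Finset.univ.filter fun i => p + δ ≤ lev i).card ∧
      ((D : ℝ) - 1) / (2 * M) ≤ D ^ 2 * spectralGap G := by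
  have hcard : M ≤ 4 * (Finset.univ.filter fun i => broomLevel M D i ≤ D / 3).card ∧
      M ≤ 4 * (Finset.univ.filter fun i => D / 3 + (D - 2 * (D / 3)) ≤ broomLevel M D i).card := by
    constructor
    · have h := le_card_of_forall_lt (n := (M - D - 1) / 2 + D / 3 + 1)
        (Finset.univ.filter fun i => broomLevel M D i ≤ D / 3) 0 (by omega) (fun i _ hi => by
          rw [Finset.mem_filter, broomLevel]
          exact ⟨Finset.mem_univ _, by omega⟩)
      omega
    · have h := le_card_of_forall_lt (n := M - ((M - D - 1) / 2 + (D - D / 3)))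
        (Finset.univ.filter fun i => D / 3 + (D - 2 * (D / 3)) ≤ broomLevel M D i)
        ((M - D - 1) / 2 + (D - D / 3)) (by omega) (fun i hi _ => by
          rw [Finset.mem_filter, broomLevel]
          exact ⟨Finset.mem_univ _, by omega⟩)
      omega
  rcases hD.eq_or_lt with rfl | hD2
  -- For `D = 1` the broom is complete bipartite and may have diameter `2`, so the complete graph
  -- replaces it. The levels are only `0` and `1`, and the spectral claim has left side `0`.
  · have : Nontrivial (Fin M) := Fin.nontrivial_iff_two_le.mpr hDM
    refine ⟨⊤, broomLevel M 1, 1 / 3, 1 - 2 * (1 / 3), ⟨SimpleGraph.connected_top, ?_⟩, ?_,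
      by omega, by omega, hcard.1, hcard.2, ?_⟩
    · exact SimpleGraph.diam_top
    · intro i j _
      have := broomLevel_le (D := 1) i
      omega
    · have h0 := spectralGap_nonneg fun i => deg_pos SimpleGraph.connected_top hDM i
      simpa using h0
  · refine ⟨broom M D, broomLevel M D, D / 3, D - 2 * (D / 3), broom_inNetworkClass hD2 hDM, ?_,
      by omega, by omega, hcard.1, hcard.2, le_spectralGap_broom hD2 hDM⟩
    intro i j h
    rcases h with h | h <;> omega

/-! ### One-variable profiles and the link function -/

section Profiles

/-- The even profile `a² / (1 + a²)`. -/
def rho (a : ℝ) : ℝ := a ^ 2 / (1 + a ^ 2)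

/-- The derivative of `rho`. -/
def rhoDeriv (a : ℝ) : ℝ := 2 * a / (1 + a ^ 2) ^ 2

/-- The odd profile `a |a| / (1 + a²)`. -/
def sgnRho (a : ℝ) : ℝ := a * |a| / (1 + a ^ 2)

theorem one_add_sq_pos (a : ℝ) : 0 < 1 + a ^ 2 := by positivity

theorem hasDerivAt_rho (a : ℝ) : HasDerivAt rho (rhoDeriv a) a := by
  have h := ((hasDerivAt_id a).pow 2).fun_div (((hasDerivAt_id a).pow 2).const_add 1)
    (one_add_sq_pos a).ne'
  refine h.congr_deriv ?_
  simp only [id, Pi.pow_apply, rhoDeriv]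
  congr 1
  norm_num
  ring

/-- The kink of `|a|` is harmless because `a * |a|` is `o(a)` at `0`. -/
theorem hasDerivAt_mul_abs (a : ℝ) : HasDerivAt (fun a : ℝ => a * |a|) (2 * |a|) a := by
  rcases lt_trichotomy a 0 with h | rfl | h
  · have h1 : HasDerivAt (fun a : ℝ => -(a ^ 2)) (2 * |a|) a := by
      refine (hasDerivAt_pow 2 a).fun_neg.congr_deriv ?_
      rw [abs_of_neg h]
      norm_num
    refine h1.congr_of_eventuallyEq ?_
    filter_upwards [eventually_lt_nhds h] with b hb
    rw [abs_of_neg hb]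
    ring
  · rw [hasDerivAt_iff_isLittleO_nhds_zero]
    simp only [zero_add, abs_zero, mul_zero, sub_zero, smul_eq_mul]
    have h := ((continuous_abs (G := ℝ)).tendsto 0)
    rw [abs_zero] at h
    have h2 := (Asymptotics.isBigO_refl (fun h : ℝ => h) (nhds 0)).mul_isLittleO
      ((Asymptotics.isLittleO_one_iff ℝ).2 h)
    simpa using h2
  · have h1 : HasDerivAt (fun a : ℝ => a ^ 2) (2 * |a|) a := by
      refine (hasDerivAt_pow 2 a).congr_deriv ?_
      rw [abs_of_pos h]
      norm_num
    refine h1.congr_of_eventuallyEq ?_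
    filter_upwards [eventually_gt_nhds h] with b hb
    rw [abs_of_pos hb]
    ring

theorem hasDerivAt_sgnRho (a : ℝ) : HasDerivAt sgnRho |rhoDeriv a| a := by
  have h := (hasDerivAt_mul_abs a).fun_div (((hasDerivAt_id a).pow 2).const_add 1)
    (one_add_sq_pos a).ne'
  refine h.congr_deriv ?_
  simp only [id, Pi.pow_apply, rhoDeriv]
  rw [abs_div, abs_of_pos (pow_pos (one_add_sq_pos a) 2), abs_mul, abs_of_pos (two_pos (α := ℝ))]
  congr 1
  norm_num
  ring

theorem rho_nonneg (a : ℝ) : 0 ≤ rho a := by unfold rho; positivity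

theorem rho_le_one (a : ℝ) : rho a ≤ 1 := by
  rw [rho, div_le_one (one_add_sq_pos a)]
  linarith

theorem half_le_rho {a : ℝ} (h : 1 ≤ |a|) : 1 / 2 ≤ rho a := by
  rw [rho, div_le_div_iff₀ two_pos (one_add_sq_pos a)]
  nlinarith [sq_abs a]

theorem abs_sgnRho_le (a : ℝ) : |sgnRho a| ≤ 1 := by
  rw [sgnRho, abs_div, abs_mul, abs_abs, abs_of_pos (one_add_sq_pos a), abs_mul_abs_self,
    div_le_one (one_add_sq_pos a)]
  nlinarith

theorem abs_rhoDeriv_le (a : ℝ) : |rhoDeriv a| ≤ 1 := by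
  rw [rhoDeriv, abs_div, abs_of_pos (pow_pos (one_add_sq_pos a) 2),
    div_le_one (pow_pos (one_add_sq_pos a) 2), abs_le]
  constructor <;> nlinarith [sq_nonneg (a - 1), sq_nonneg (a + 1), sq_nonneg (a ^ 2)]

theorem hasDerivAt_rhoDeriv (a : ℝ) :
    HasDerivAt rhoDeriv ((2 - 6 * a ^ 2) / (1 + a ^ 2) ^ 3) a := by
  have h := ((hasDerivAt_id a).const_mul 2).fun_div ((((hasDerivAt_id a).pow 2).const_add 1).pow 2)
    (pow_pos (one_add_sq_pos a) 2).ne'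
  refine h.congr_deriv ?_
  simp only [id, Pi.pow_apply]
  have := (one_add_sq_pos a).ne'
  field_simp
  norm_num
  ring

theorem abs_sub_le_of_hasDerivAt {g g' : ℝ → ℝ} {C : ℝ} (hg : ∀ a, HasDerivAt g (g' a) a)
    (hC : ∀ a, |g' a| ≤ C) (a b : ℝ) : |g a - g b| ≤ C * |a - b| :=
  convex_univ.norm_image_sub_le_of_norm_hasDerivWithin_le
    (fun x _ => (hg x).hasDerivWithinAt) (fun x _ => hC x) (Set.mem_univ b) (Set.mem_univ a)

theorem abs_rho_sub_le (a b : ℝ) : |rho a - rho b| ≤ |a - b| := by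
  simpa using abs_sub_le_of_hasDerivAt hasDerivAt_rho abs_rhoDeriv_le a b

theorem abs_rhoDeriv_sub_le (a b : ℝ) : |rhoDeriv a - rhoDeriv b| ≤ 2 * |a - b| := by
  refine abs_sub_le_of_hasDerivAt hasDerivAt_rhoDeriv (fun a => ?_) a b
  rw [abs_div, abs_of_pos (pow_pos (one_add_sq_pos a) 3),
    div_le_iff₀ (pow_pos (one_add_sq_pos a) 3), abs_le]
  constructor <;> nlinarith [sq_nonneg a, pow_nonneg (sq_nonneg a) 2, pow_nonneg (sq_nonneg a) 3]

theorem abs_arctan_le (a : ℝ) : |Real.arctan a| ≤ 2 := by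
  rw [abs_le]
  constructor <;> linarith [Real.arctan_lt_pi_div_two a, Real.neg_pi_div_two_lt_arctan a,
    Real.pi_lt_four]

theorem inv_one_add_sq_le_one (a : ℝ) : 1 / (1 + a ^ 2) ≤ 1 := by
  rw [div_le_one (one_add_sq_pos a)]
  nlinarith [sq_nonneg a]

theorem abs_arctan_sub_le (a b : ℝ) : |Real.arctan a - Real.arctan b| ≤ |a - b| := by
  have := abs_sub_le_of_hasDerivAt Real.hasDerivAt_arctan (C := 1) (fun a => by
    rw [abs_of_pos (by positivity)]
    exact inv_one_add_sq_le_one a) a b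
  simpa using this

theorem abs_inv_one_add_sq_sub_le (a b : ℝ) :
    |1 / (1 + a ^ 2) - 1 / (1 + b ^ 2)| ≤ |a - b| := by
  have ha := one_add_sq_pos a
  have hb := one_add_sq_pos b
  have h : 1 / (1 + a ^ 2) - 1 / (1 + b ^ 2) =
      -((a + b) / ((1 + a ^ 2) * (1 + b ^ 2))) * (a - b) := by
    field_simp
    ring
  rw [h, abs_mul, abs_neg, abs_div, abs_of_pos (mul_pos ha hb)]
  refine mul_le_of_le_one_left (abs_nonneg _) ?_
  rw [div_le_one (mul_pos ha hb), abs_le]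
  constructor <;> nlinarith [sq_nonneg (a - 1), sq_nonneg (a + 1), sq_nonneg (b - 1),
    sq_nonneg (b + 1), mul_nonneg (sq_nonneg a) (sq_nonneg b)]

/-- The link between two consecutive coordinates of the chain. -/
def link (a b : ℝ) : ℝ := -(rho a * Real.arctan b) - 2 * sgnRho a

/-- The derivative of `link` in its first variable. -/
def linkFst (a b : ℝ) : ℝ := -(rhoDeriv a * Real.arctan b) - 2 * |rhoDeriv a|

/-- The derivative of `link` in its second variable. -/
def linkSnd (a b : ℝ) : ℝ := -(rho a * (1 / (1 + b ^ 2)))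

@[simp] theorem link_zero_left (b : ℝ) : link 0 b = 0 := by simp [link, rho, sgnRho]

@[simp] theorem linkFst_zero_left (b : ℝ) : linkFst 0 b = 0 := by simp [linkFst, rhoDeriv]

@[simp] theorem linkSnd_zero_left (b : ℝ) : linkSnd 0 b = 0 := by simp [linkSnd, rho]

theorem link_one_zero : link 1 0 = -1 := by norm_num [link, rho, sgnRho]

theorem linkSnd_one_zero : linkSnd 1 0 = -(1 / 2) := by norm_num [linkSnd, rho]

theorem neg_four_le_link (a b : ℝ) : -4 ≤ link a b := by
  have h1 := abs_sgnRho_le a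
  have h2 : |rho a * Real.arctan b| ≤ 1 * 2 := by
    rw [abs_mul, abs_of_nonneg (rho_nonneg a)]
    exact mul_le_mul (rho_le_one a) (abs_arctan_le b) (abs_nonneg _) zero_le_one
  rw [abs_le] at h1 h2
  unfold link
  linarith

/-- The term `2 * sgnRho` exists for this: its derivative `2 * |rhoDeriv a|` dominates the arctan
term, as `|arctan| ≤ 2`. The two links meeting at a coordinate then cannot cancel in the gradient.
-/
theorem linkFst_nonpos (a b : ℝ) : linkFst a b ≤ 0 := by
  have h : |rhoDeriv a * Real.arctan b| ≤ |rhoDeriv a| * 2 := by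
    rw [abs_mul]
    exact mul_le_mul_of_nonneg_left (abs_arctan_le b) (abs_nonneg _)
  unfold linkFst
  linarith [neg_abs_le (rhoDeriv a * Real.arctan b)]

theorem linkSnd_le {a b : ℝ} (ha : 1 ≤ |a|) (hb : |b| < 1) : linkSnd a b ≤ -(1 / 4) := by
  have h1 := half_le_rho ha
  have h2 : 1 / 2 ≤ 1 / (1 + b ^ 2) := by
    apply one_div_le_one_div_of_le (one_add_sq_pos b)
    nlinarith [sq_abs b, abs_nonneg b]
  unfold linkSnd
  nlinarith

theorem abs_linkFst_sub_le (a b a' b' : ℝ) :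
    |linkFst a b - linkFst a' b'| ≤ 8 * |a - a'| + |b - b'| := by
  have h1 := abs_rhoDeriv_sub_le a a'
  have h2 : |(rhoDeriv a - rhoDeriv a') * Real.arctan b| ≤ 2 * |a - a'| * 2 := by
    rw [abs_mul]
    exact mul_le_mul h1 (abs_arctan_le b) (abs_nonneg _) (by positivity)
  have h3 : |rhoDeriv a' * (Real.arctan b - Real.arctan b')| ≤ 1 * |b - b'| := by
    rw [abs_mul]
    exact mul_le_mul (abs_rhoDeriv_le a') (abs_arctan_sub_le b b') (abs_nonneg _) zero_le_one
  have h4 := (abs_abs_sub_abs_le_abs_sub (rhoDeriv a) (rhoDeriv a')).trans h1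
  have h5 : linkFst a b - linkFst a' b' = -((rhoDeriv a - rhoDeriv a') * Real.arctan b)
      - rhoDeriv a' * (Real.arctan b - Real.arctan b') - 2 * (|rhoDeriv a| - |rhoDeriv a'|) := by
    unfold linkFst
    ring
  rw [h5, abs_le]
  rw [abs_le] at h2 h3 h4
  constructor <;> linarith

theorem abs_linkSnd_sub_le (a b a' b' : ℝ) :
    |linkSnd a b - linkSnd a' b'| ≤ |a - a'| + |b - b'| := by
  have h2 : |(rho a - rho a') * (1 / (1 + b ^ 2))| ≤ |a - a'| * 1 := by
    rw [abs_mul, abs_of_pos (one_div_pos.2 (one_add_sq_pos b))]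
    exact mul_le_mul (abs_rho_sub_le a a') (inv_one_add_sq_le_one b)
      (one_div_pos.2 (one_add_sq_pos b)).le (abs_nonneg _)
  have h3 : |rho a' * (1 / (1 + b ^ 2) - 1 / (1 + b' ^ 2))| ≤ 1 * |b - b'| := by
    rw [abs_mul, abs_of_nonneg (rho_nonneg a')]
    exact mul_le_mul (rho_le_one a') (abs_inv_one_add_sq_sub_le b b') (abs_nonneg _) zero_le_one
  have h5 : linkSnd a b - linkSnd a' b' = -((rho a - rho a') * (1 / (1 + b ^ 2)))
      - rho a' * (1 / (1 + b ^ 2) - 1 / (1 + b' ^ 2)) := by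
    unfold linkSnd
    ring
  rw [h5, abs_le]
  rw [abs_le] at h2 h3
  constructor <;> linarith

end Profiles

/-! ### The chain function: gradient, smoothness and slow discovery -/

section Chain

variable {S : ℕ}

theorem hasFDerivAt_link {p q : Vec S → ℝ} {p' q' : Vec S →L[ℝ] ℝ} {x : Vec S}
    (hp : HasFDerivAt p p' x) (hq : HasFDerivAt q q' x) :
    HasFDerivAt (fun x => link (p x) (q x))
      (linkFst (p x) (q x) • p' + linkSnd (p x) (q x) • q') x := by
  have h1 := (hasDerivAt_rho (p x)).comp_hasFDerivAt x hp
  have h2 := (Real.hasDerivAt_arctan (q x)).comp_hasFDerivAt x hq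
  have h3 := (hasDerivAt_sgnRho (p x)).comp_hasFDerivAt x hp
  refine (((h1.mul h2).neg).sub (h3.const_mul 2)).congr_fderiv ?_
  ext y
  simp [linkFst, linkSnd]
  ring

/-- The coordinates of the chain along `u`, preceded by the constant `1`. -/
def chainVar (u : ℕ → Vec S) (x : Vec S) : ℕ → ℝ
  | 0 => 1
  | k + 1 => inner ℝ (u k) x

/-- The weighted chain with `n` links along `u 0, …, u (n - 1)`, and a quadratic along `u n`. -/
def chainFun (U : ℝ) (n : ℕ) (α : ℕ → ℝ) (u : ℕ → Vec S) (x : Vec S) : ℝ :=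
  ∑ k ∈ Finset.range n, α k * link (chainVar u x k) (chainVar u x (k + 1)) +
    U / 2 * inner ℝ (u n) x ^ 2

/-- The coordinates of the gradient of `chainFun`. -/
def chainCoef (U : ℝ) (n : ℕ) (α : ℕ → ℝ) (u : ℕ → Vec S) (x : Vec S) (j : ℕ) : ℝ :=
  if j < n then α j * linkSnd (chainVar u x j) (chainVar u x (j + 1)) +
    α (j + 1) * linkFst (chainVar u x (j + 1)) (chainVar u x (j + 2))
  else U * inner ℝ (u j) x

variable {U : ℝ} {n : ℕ} {α : ℕ → ℝ} {u : ℕ → Vec S}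

theorem hasGradientAt_chainFun (hα : α n = 0) (x : Vec S) :
    HasGradientAt (chainFun U n α u)
      (∑ j ∈ Finset.range (n + 1), chainCoef U n α u x j • u j) x := by
  set e : ℕ → Vec S →L[ℝ] ℝ := fun k => Nat.casesOn k 0 fun k => innerSL ℝ (u k) with he
  have hZ : ∀ k, HasFDerivAt (fun x => chainVar u x k) (e k) x := by
    intro k
    cases k with
    | zero => exact hasFDerivAt_const 1 x
    | succ k => exact (innerSL ℝ (u k)).hasFDerivAt
  have h1 := (HasFDerivAt.fun_sum (u := Finset.range n) fun k _ =>
    (hasFDerivAt_link (hZ k) (hZ (k + 1))).const_mul (α k)).add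
    ((((innerSL ℝ (u n)).hasFDerivAt (x := x)).pow 2).const_mul (U / 2))
  rw [hasGradientAt_iff_hasFDerivAt]
  refine h1.congr_fderiv ?_
  ext y
  -- Index shift: the term at `0` drops because the head is constant, the term at `n` because `α n =
  -- 0`.
  have h2 : ∑ k ∈ Finset.range n, α k * linkFst (chainVar u x k) (chainVar u x (k + 1)) * e k y =
      ∑ k ∈ Finset.range n, α (k + 1) *
        linkFst (chainVar u x (k + 1)) (chainVar u x (k + 2)) * inner ℝ (u k) y := by
    have h3 := Finset.sum_range_succ' (fun k =>
      α k * linkFst (chainVar u x k) (chainVar u x (k + 1)) * e k y) n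
    rw [Finset.sum_range_succ, hα] at h3
    simpa [he] using h3
  rw [InnerProductSpace.toDual_apply_apply, sum_inner, Finset.sum_range_succ, add_apply]
  simp_rw [real_inner_smul_left]
  congr 1
  · rw [sum_apply]
    have h4 : ∀ k ∈ Finset.range n, chainCoef U n α u x k * inner ℝ (u k) y =
        α k * linkSnd (chainVar u x k) (chainVar u x (k + 1)) * inner ℝ (u k) y +
        α (k + 1) * linkFst (chainVar u x (k + 1)) (chainVar u x (k + 2)) * inner ℝ (u k) y := by
      intro k hk
      rw [chainCoef, if_pos (Finset.mem_range.1 hk)]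
      ring
    rw [Finset.sum_congr rfl h4, Finset.sum_add_distrib, ← h2, ← Finset.sum_add_distrib]
    refine Finset.sum_congr rfl fun k _ => ?_
    simp [he]
    ring
  · simp [chainCoef]
    ring

theorem gradient_chainFun (hα : α n = 0) (x : Vec S) : gradient (chainFun U n α u) x =
    ∑ j ∈ Finset.range (n + 1), chainCoef U n α u x j • u j :=
  (hasGradientAt_chainFun hα x).gradient

theorem differentiable_chainFun (hα : α n = 0) : Differentiable ℝ (chainFun U n α u) :=
  fun x => (hasGradientAt_chainFun hα x).differentiableAt

theorem norm_sq_sum_smul (hu : Orthonormal ℝ fun k : Fin (n + 1) => u k) (c : ℕ → ℝ) :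
    ‖∑ j ∈ Finset.range (n + 1), c j • u j‖ ^ 2 = ∑ j ∈ Finset.range (n + 1), c j ^ 2 := by
  rw [← Fin.sum_univ_eq_sum_range (fun j => c j • u j),
    ← Fin.sum_univ_eq_sum_range (fun j => c j ^ 2), ← real_inner_self_eq_norm_sq,
    hu.inner_sum (fun k => c k) (fun k => c k)]
  simp [sq]

theorem inner_sum_smul (hu : Orthonormal ℝ fun k : Fin (n + 1) => u k) (c : ℕ → ℝ) {j : ℕ}
    (hj : j ≤ n) : inner ℝ (u j) (∑ j ∈ Finset.range (n + 1), c j • u j) = c j := by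
  rw [← Fin.sum_univ_eq_sum_range (fun j => c j • u j)]
  exact hu.inner_right_fintype (fun k => c k) ⟨j, by omega⟩

theorem sum_inner_sq_le (hu : Orthonormal ℝ fun k : Fin (n + 1) => u k) (x : Vec S) :
    ∑ j ∈ Finset.range (n + 1), inner ℝ (u j) x ^ 2 ≤ ‖x‖ ^ 2 := by
  rw [← Fin.sum_univ_eq_sum_range (fun j => inner ℝ (u j) x ^ 2)]
  simpa using hu.sum_inner_products_le x (s := Finset.univ)

/-- Cauchy–Schwarz with weights `1, 9, 1` in each row gives a factor `11`; summing the rows gives `1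
+ 9 + 1 = 11` once more, since shifting `d` does not increase its sum of squares. -/
theorem sum_sq_le_of_tridiagonal {a : ℝ} (c d : ℕ → ℝ) (hdn : d n = 0)
    (hc : ∀ j < n, |c j| ≤ a * ((if j = 0 then 0 else d (j - 1)) + 9 * d j + d (j + 1))) :
    ∑ j ∈ Finset.range n, c j ^ 2 ≤ (11 * a) ^ 2 * ∑ j ∈ Finset.range n, d j ^ 2 := by
  set e : ℕ → ℝ := fun j => if j = 0 then 0 else d (j - 1) with he
  have hsucc : ∑ j ∈ Finset.range n, d (j + 1) ^ 2 ≤ ∑ j ∈ Finset.range n, d j ^ 2 := by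
    have h := Finset.sum_range_succ' (fun j => d j ^ 2) n
    rw [Finset.sum_range_succ, hdn] at h
    nlinarith [sq_nonneg (d 0)]
  have hpred : ∑ j ∈ Finset.range n, e j ^ 2 ≤ ∑ j ∈ Finset.range n, d j ^ 2 := by
    have h := Finset.sum_range_succ' (fun j => e j ^ 2) n
    rw [Finset.sum_range_succ] at h
    simp only [he, Nat.add_sub_cancel, Nat.succ_ne_zero, if_false, if_true] at h
    nlinarith [sq_nonneg (e n)]
  calc ∑ j ∈ Finset.range n, c j ^ 2
      ≤ ∑ j ∈ Finset.range n, 11 * a ^ 2 * (e j ^ 2 + 9 * d j ^ 2 + d (j + 1) ^ 2) := by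
        refine Finset.sum_le_sum fun j hj => ?_
        have h := hc j (Finset.mem_range.1 hj)
        rw [← sq_abs]
        calc |c j| ^ 2 ≤ (a * (e j + 9 * d j + d (j + 1))) ^ 2 :=
              pow_le_pow_left₀ (abs_nonneg _) h 2
          _ = a ^ 2 * (e j + 9 * d j + d (j + 1)) ^ 2 := mul_pow _ _ _
          _ ≤ a ^ 2 * (11 * (e j ^ 2 + 9 * d j ^ 2 + d (j + 1) ^ 2)) := by
              refine mul_le_mul_of_nonneg_left ?_ (sq_nonneg a)
              nlinarith [sq_nonneg (e j - d j), sq_nonneg (d j - d (j + 1)),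
                sq_nonneg (e j - d (j + 1))]
          _ = _ := by ring
    _ = 11 * a ^ 2 * (∑ j ∈ Finset.range n, e j ^ 2 + 9 * ∑ j ∈ Finset.range n, d j ^ 2 +
          ∑ j ∈ Finset.range n, d (j + 1) ^ 2) := by
        rw [← Finset.mul_sum, Finset.sum_add_distrib, Finset.sum_add_distrib, Finset.mul_sum]
    _ ≤ 11 * a ^ 2 * (∑ j ∈ Finset.range n, d j ^ 2 + 9 * ∑ j ∈ Finset.range n, d j ^ 2 +
          ∑ j ∈ Finset.range n, d j ^ 2) := by gcongr
    _ = _ := by ring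

/-- Coordinate `j` of the gradient involves only its two neighbours, with Lipschitz weights `1`, `1
+ 8` and `1`, whence the `11` in `hα1`. The quadratic along `u n` decouples, as `α n = 0`. -/
theorem norm_gradient_chainFun_sub_le (hu : Orthonormal ℝ fun k : Fin (n + 1) => u k)
    (hU : 0 ≤ U) (hα0 : ∀ k, 0 ≤ α k) (hα1 : ∀ k, 11 * α k ≤ U) (hα : α n = 0) (x z : Vec S) :
    ‖gradient (chainFun U n α u) x - gradient (chainFun U n α u) z‖ ≤ U * ‖x - z‖ := by
  refine abs_le_of_sq_le_sq' ?_ (by positivity) |>.2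
  rw [gradient_chainFun hα, gradient_chainFun hα, ← Finset.sum_sub_distrib]
  simp_rw [← sub_smul]
  rw [norm_sq_sum_smul hu (fun j => chainCoef U n α u x j - chainCoef U n α u z j), mul_pow]
  refine le_trans ?_ (mul_le_mul_of_nonneg_left (sum_inner_sq_le hu (x - z)) (sq_nonneg U))
  rw [Finset.sum_range_succ, Finset.sum_range_succ, mul_add]
  set d : ℕ → ℝ := fun k => if k < n then |inner ℝ (u k) (x - z)| else 0 with hd
  have hd0 : ∀ k, 0 ≤ d k := fun k => by simp only [hd]; split_ifs <;> positivity
  have hdsum : ∑ j ∈ Finset.range n, d j ^ 2 =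
      ∑ j ∈ Finset.range n, inner ℝ (u j) (x - z) ^ 2 :=
    Finset.sum_congr rfl fun j hj => by
      simp only [hd, if_pos (Finset.mem_range.1 hj), sq_abs]
  have hvar : ∀ k, chainVar u x (k + 1) - chainVar u z (k + 1) = inner ℝ (u k) (x - z) :=
    fun k => by simp [chainVar, inner_sub_right]
  have hα' : ∀ k, α k ≤ U / 11 := fun k => by linarith [hα1 k]
  gcongr
  · rw [← hdsum]
    have h := sum_sq_le_of_tridiagonal (n := n) (a := U / 11)
      (fun j => chainCoef U n α u x j - chainCoef U n α u z j) d (by simp [hd]) (by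
        intro j hj
        simp only [chainCoef, if_pos hj]
        have h1 := abs_linkSnd_sub_le (chainVar u x j) (chainVar u x (j + 1))
          (chainVar u z j) (chainVar u z (j + 1))
        have h2 := abs_linkFst_sub_le (chainVar u x (j + 1)) (chainVar u x (j + 2))
          (chainVar u z (j + 1)) (chainVar u z (j + 2))
        have hj1 : |chainVar u x (j + 1) - chainVar u z (j + 1)| = d j := by
          rw [hvar]; simp only [hd, if_pos hj]
        have hj0 : |chainVar u x j - chainVar u z j| = if j = 0 then 0 else d (j - 1) := by
          cases j with
          | zero => simp [chainVar]
          | succ k =>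
            rw [hvar, if_neg (Nat.succ_ne_zero k), Nat.add_sub_cancel]
            simp only [hd, if_pos (by omega : k < n)]
        rw [hj1] at h1 h2
        rw [hj0] at h1
        have hj2 : α (j + 1) * |linkFst (chainVar u x (j + 1)) (chainVar u x (j + 2)) -
            linkFst (chainVar u z (j + 1)) (chainVar u z (j + 2))| ≤
            U / 11 * (8 * d j + d (j + 1)) := by
          by_cases hjn : j + 1 < n
          · have : |chainVar u x (j + 2) - chainVar u z (j + 2)| = d (j + 1) := by
              rw [hvar]; simp only [hd, if_pos hjn]
            rw [this] at h2
            exact mul_le_mul (hα' _) h2 (abs_nonneg _) (by positivity)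
          · have : j + 1 = n := by omega
            rw [this, hα, zero_mul]
            have := hd0 j
            have := hd0 n
            positivity
        have hj3 : α j * |linkSnd (chainVar u x j) (chainVar u x (j + 1)) -
            linkSnd (chainVar u z j) (chainVar u z (j + 1))| ≤
            U / 11 * ((if j = 0 then 0 else d (j - 1)) + d j) :=
          mul_le_mul (hα' _) h1 (abs_nonneg _) (by positivity)
        rw [← abs_of_nonneg (hα0 j), ← abs_mul, abs_le] at hj3
        rw [← abs_of_nonneg (hα0 (j + 1)), ← abs_mul, abs_le] at hj2
        rw [abs_le]
        constructor <;> linarith)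
    refine h.trans (le_of_eq ?_)
    ring
  · simp only [chainCoef, lt_irrefl, if_false]
    rw [← mul_sub, ← inner_sub_right, mul_pow]

/-- The quadratic along `u n` is there to make `U` sharp: the pair `u n`, `0` attains it, whatever
the link weights are. -/
theorem isLeast_lipschitz_chainFun (hu : Orthonormal ℝ fun k : Fin (n + 1) => u k)
    (hU : 0 ≤ U) (hα0 : ∀ k, 0 ≤ α k) (hα1 : ∀ k, 11 * α k ≤ U) (hα : α n = 0) :
    IsLeast {L : ℝ | 0 ≤ L ∧ ∀ x z, ‖gradient (chainFun U n α u) x -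
      gradient (chainFun U n α u) z‖ ≤ L * ‖x - z‖} U := by
  refine ⟨⟨hU, norm_gradient_chainFun_sub_le hu hU hα0 hα1 hα⟩, fun L hL => ?_⟩
  have h := hL.2 (u n) 0
  have hn : ‖u n‖ = 1 := hu.1 (Fin.last n)
  rw [sub_zero, hn, mul_one] at h
  have h2 := abs_real_inner_le_norm (u n)
    (gradient (chainFun U n α u) (u n) - gradient (chainFun U n α u) 0)
  have h3 : inner ℝ (u n) (gradient (chainFun U n α u) (u n) - gradient (chainFun U n α u) 0) =
      U := by
    rw [inner_sub_right, gradient_chainFun hα, gradient_chainFun hα,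
      inner_sum_smul hu _ le_rfl, inner_sum_smul hu _ le_rfl]
    simp [chainCoef, hn]
  rw [hn, one_mul, h3] at h2
  exact (le_abs_self U).trans (h2.trans h)

theorem neg_le_chainFun (hU : 0 ≤ U) (hα0 : ∀ k, 0 ≤ α k) (x : Vec S) :
    -(4 * ∑ k ∈ Finset.range n, α k) ≤ chainFun U n α u x := by
  rw [chainFun, Finset.mul_sum, ← Finset.sum_neg_distrib]
  have : 0 ≤ U / 2 * inner ℝ (u n) x ^ 2 := by positivity
  refine le_trans (Finset.sum_le_sum fun k _ => ?_) (le_add_of_nonneg_right this)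
  nlinarith [hα0 k, neg_four_le_link (chainVar u x k) (chainVar u x (k + 1))]

theorem chainFun_zero_le (hα0 : ∀ k, 0 ≤ α k) : chainFun U n α u 0 ≤ 0 := by
  simp only [chainFun, inner_zero_right, ne_eq, OfNat.ofNat_ne_zero, not_false_eq_true, zero_pow,
    mul_zero, add_zero]
  refine Finset.sum_nonpos fun k _ => ?_
  cases k with
  | zero =>
    have : link (chainVar u 0 0) (chainVar u 0 (0 + 1)) = -1 := by
      simp [chainVar, link_one_zero]
    rw [this]
    linarith [hα0 0]
  | succ k => simp [chainVar]

theorem gradient_chainFun_zero (hn : 0 < n) (hα : α n = 0) :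
    gradient (chainFun U n α u) 0 = (-(α 0 / 2)) • u 0 := by
  rw [gradient_chainFun hα, Finset.sum_range_succ', Finset.sum_eq_zero, zero_add]
  · congr 1
    rw [chainCoef, if_pos hn]
    simp [chainVar, linkSnd_one_zero]
    ring
  · intro k _
    rw [chainCoef]
    split_ifs <;> simp [chainVar]

/-- Only the first undiscovered direction can be revealed, and only by a node that owns its link. -/
theorem gradient_chainFun_mem_span (hα : α n = 0) {m : ℕ} (hm : α m = 0) {x : Vec S}
    (hx : ∀ j, m ≤ j → j ≤ n → inner ℝ (u j) x = 0) :
    gradient (chainFun U n α u) x ∈ Submodule.span ℝ (u '' Set.Iio m) := by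
  rw [gradient_chainFun hα]
  refine Submodule.sum_mem _ fun j hj => ?_
  have hjn : j ≤ n := Nat.lt_succ_iff.1 (Finset.mem_range.1 hj)
  rcases lt_or_ge j m with h | h
  · exact Submodule.smul_mem _ _ (Submodule.subset_span ⟨j, h, rfl⟩)
  · have h0 : chainCoef U n α u x j = 0 := by
      have hj0 : chainVar u x (j + 1) = 0 := hx j h hjn
      rw [chainCoef, hx j h hjn, hj0, linkFst_zero_left, mul_zero, mul_zero, add_zero]
      rcases h.eq_or_lt with rfl | h'
      · simp [hm]
      · obtain ⟨k, rfl⟩ : ∃ k, j = k + 1 := ⟨j - 1, by omega⟩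
        have : chainVar u x (k + 1) = 0 := hx k (by omega) (by omega)
        simp [this]
    rw [h0, zero_smul]
    exact Submodule.zero_mem _

theorem sum_chainCoef {M : ℕ} (w : Fin M → ℕ → ℝ) {κ : ℝ} (hw : ∀ k < n, ∑ i, w i k = κ)
    (hwn : ∀ i, w i n = 0) (x : Vec S) {j : ℕ} (hj : j < n) :
    ∑ i, chainCoef U n (w i) u x j =
      κ * linkSnd (chainVar u x j) (chainVar u x (j + 1)) +
      (if j + 1 < n then κ else 0) * linkFst (chainVar u x (j + 1)) (chainVar u x (j + 2)) := by
  simp only [chainCoef, if_pos hj]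
  rw [Finset.sum_add_distrib, ← Finset.sum_mul, ← Finset.sum_mul, hw j hj]
  congr 2
  split_ifs with h
  · exact hw _ h
  · have : j + 1 = n := by omega
    simp [this, hwn]

/-- As long as the last coordinate of the chain is small, the total gradient is large. -/
theorem le_norm_sum_gradient_chainFun (hu : Orthonormal ℝ fun k : Fin (n + 1) => u k) {M : ℕ}
    (w : Fin M → ℕ → ℝ) {κ : ℝ} (hκ : 0 ≤ κ) (hw : ∀ k < n, ∑ i, w i k = κ)
    (hwn : ∀ i, w i n = 0) {x : Vec S} {m : ℕ} (hm : m < n) (hx : inner ℝ (u m) x = 0) :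
    κ / 4 ≤ ‖∑ i, gradient (chainFun U n (w i) u) x‖ := by
  classical
  have hex : ∃ j, |chainVar u x (j + 1)| < 1 := ⟨m, by simp [chainVar, hx]⟩
  -- At the first coordinate below `1` the preceding one is at least `1` in absolute value (the head
  -- is `1`), so link `j` contributes slope at most `-κ / 4`.
  obtain ⟨j, hj, hjmin⟩ : ∃ j, |chainVar u x (j + 1)| < 1 ∧
      ∀ k < j, 1 ≤ |chainVar u x (k + 1)| :=
    ⟨Nat.find hex, Nat.find_spec hex, fun k hk => not_lt.1 (Nat.find_min hex hk)⟩
  have hjm : j ≤ m := by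
    by_contra h
    have := hjmin m (by omega)
    simp [chainVar, hx] at this
    linarith
  have hprev : 1 ≤ |chainVar u x j| := by
    cases j with
    | zero => simp [chainVar]
    | succ k => exact hjmin k (Nat.lt_succ_self k)
  have hin := abs_real_inner_le_norm (u j) (∑ i, gradient (chainFun U n (w i) u) x)
  have hn : ‖u j‖ = 1 := hu.1 ⟨j, by omega⟩
  rw [hn, one_mul, inner_sum] at hin
  have hco : ∀ i, inner ℝ (u j) (gradient (chainFun U n (w i) u) x) =
      chainCoef U n (w i) u x j := fun i => by
    rw [gradient_chainFun (hwn i), inner_sum_smul hu _ (by omega)]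
  simp_rw [hco] at hin
  rw [sum_chainCoef w hw hwn x (by omega)] at hin
  refine le_trans ?_ hin
  have h1 := linkSnd_le hprev hj
  have h2 := linkFst_nonpos (chainVar u x (j + 1)) (chainVar u x (j + 2))
  have h3 : 0 ≤ if j + 1 < n then κ else 0 := by split_ifs <;> linarith
  refine le_trans ?_ (neg_le_abs _)
  nlinarith [mul_nonneg h3 (neg_nonneg.2 h2)]

end Chain

/-! ### Directions orthogonal to all words in the operators -/

section Expansion

theorem finrank_finset_sup_le {V ι : Type*} [AddCommGroup V] [Module ℝ V]
    [FiniteDimensional ℝ V] {n : ℕ} (s : Finset ι) (W : ι → Submodule ℝ V)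
    (hW : ∀ i, Module.finrank ℝ (W i) ≤ n) :
    Module.finrank ℝ (s.sup W : Submodule ℝ V) ≤ s.card * n := by
  classical
  induction s using Finset.induction_on with
  | empty => simp
  | insert i s hi ih =>
    rw [Finset.sup_insert, Finset.card_insert_of_notMem hi]
    have := Submodule.finrank_add_le_finrank_add_finrank (W i) (s.sup W)
    have := hW i
    linarith

variable {V : Type*} [NormedAddCommGroup V] [InnerProductSpace ℝ V] {ι : Type*} [Fintype ι]
  (ops : ι → V →ₗ[ℝ] V)

/-- A subspace together with its images under the operators. -/
def expand (W : Submodule ℝ V) : Submodule ℝ V := W ⊔ Finset.univ.sup fun i => W.map (ops i)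

theorem le_expand (W : Submodule ℝ V) : W ≤ expand ops W := le_sup_left

theorem apply_mem_expand {W : Submodule ℝ V} (i : ι) {v : V} (hv : v ∈ W) :
    ops i v ∈ expand ops W :=
  (le_sup_right : _ ≤ expand ops W) <|
    (Finset.le_sup (f := fun i => W.map (ops i)) (Finset.mem_univ i))
      (Submodule.mem_map_of_mem hv)

theorem expand_mono : Monotone (expand ops) := fun _ _ h =>
  sup_le_sup h (Finset.sup_mono_fun fun _ _ => Submodule.map_mono h)

theorem monotone_iterate_expand (W : Submodule ℝ V) : Monotone fun t => (expand ops)^[t] W :=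
  monotone_nat_of_le_succ fun t => by
    rw [Function.iterate_succ_apply']
    exact le_expand ops _

theorem le_iterate_expand (t : ℕ) (W : Submodule ℝ V) : W ≤ (expand ops)^[t] W :=
  monotone_iterate_expand ops W (Nat.zero_le t)

theorem orthonormal_of_adapted {ops : ι → V →ₗ[ℝ] V} {u : ℕ → V} {H N : ℕ} (hu : ∀ k ≤ N, ‖u k‖ = 1 ∧
    u k ∈ ((expand ops)^[H] (Submodule.span ℝ (u '' Set.Iio k)))ᗮ) :
    Orthonormal ℝ fun k : Fin (N + 1) => u k := by
  have h : ∀ i j : ℕ, i < j → j ≤ N → inner ℝ (u i) (u j) = 0 := fun i j hij hj =>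
    (Submodule.mem_orthogonal _ _).1 (hu j hj).2 _
      (le_iterate_expand ops H _ (Submodule.subset_span ⟨i, hij, rfl⟩))
  refine ⟨fun k => (hu k (Nat.lt_succ_iff.1 k.2)).1, fun i j hij => ?_⟩
  rcases lt_or_gt_of_ne (Fin.val_ne_of_ne hij) with hlt | hlt
  · exact h _ _ hlt (Nat.lt_succ_iff.1 j.2)
  · change inner ℝ (u i) (u j) = 0
    rw [real_inner_comm]
    exact h _ _ hlt (Nat.lt_succ_iff.1 i.2)

theorem inner_eq_zero_of_mem_iterate {ops : ι → V →ₗ[ℝ] V} {u : ℕ → V} {H N : ℕ} (hu : ∀ k ≤ N, ‖u k‖ = 1 ∧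
    u k ∈ ((expand ops)^[H] (Submodule.span ℝ (u '' Set.Iio k)))ᗮ) {t m j : ℕ} (ht : t ≤ H)
    (hmj : m ≤ j) (hj : j ≤ N) {x : V}
    (hx : x ∈ (expand ops)^[t] (Submodule.span ℝ (u '' Set.Iio m))) : inner ℝ (u j) x = 0 := by
  rw [real_inner_comm]
  refine (Submodule.mem_orthogonal _ _).1 (hu j hj).2 _ ?_
  refine (monotone_iterate_expand ops _ ht) (((expand_mono ops).iterate t) ?_ hx)
  exact Submodule.span_mono (Set.image_mono fun i hi => lt_of_lt_of_le hi hmj)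

variable [FiniteDimensional ℝ V]

/-- This finite growth is what makes a large dimension leave room for a new direction. -/
theorem finrank_iterate_expand_le (t : ℕ) (W : Submodule ℝ V) :
    Module.finrank ℝ ((expand ops)^[t] W : Submodule ℝ V) ≤
      (1 + Fintype.card ι) ^ t * Module.finrank ℝ W := by
  induction t with
  | zero => rw [pow_zero, one_mul, Function.iterate_zero, id]
  | succ t ih =>
    rw [Function.iterate_succ_apply']
    set X := (expand ops)^[t] W
    have h1 := Submodule.finrank_add_le_finrank_add_finrank X
      (Finset.univ.sup fun i => X.map (ops i))
    have h2 := finrank_finset_sup_le Finset.univ (fun i => X.map (ops i))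
      fun i => Submodule.finrank_map_le (ops i) X
    rw [Finset.card_univ] at h2
    calc _ ≤ (1 + Fintype.card ι) * Module.finrank ℝ X := by
          rw [expand]; linarith
      _ ≤ (1 + Fintype.card ι) * ((1 + Fintype.card ι) ^ t * Module.finrank ℝ W) := by gcongr
      _ = _ := by ring

/-- Unit vectors, each orthogonal to whatever the operators make of the previous ones. -/
theorem exists_adapted_unit_vectors (H N : ℕ)
    (hV : (1 + Fintype.card ι) ^ H * N < Module.finrank ℝ V) :
    ∃ u : ℕ → V, ∀ k ≤ N, ‖u k‖ = 1 ∧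
      u k ∈ ((expand ops)^[H] (Submodule.span ℝ (u '' Set.Iio k)))ᗮ := by
  classical
  have key : ∀ n ≤ N + 1, ∃ u : ℕ → V, ∀ k < n, ‖u k‖ = 1 ∧
      u k ∈ ((expand ops)^[H] (Submodule.span ℝ (u '' Set.Iio k)))ᗮ := by
    intro n
    induction n with
    | zero => exact fun _ => ⟨0, fun k hk => absurd hk (Nat.not_lt_zero k)⟩
    | succ n ih =>
      intro hn
      obtain ⟨u, hu⟩ := ih (by omega)
      set X := (expand ops)^[H] (Submodule.span ℝ (u '' Set.Iio n)) with hX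
      have hspan : Module.finrank ℝ (Submodule.span ℝ (u '' Set.Iio n)) ≤ n := by
        have h := finrank_span_finset_le_card (R := ℝ) ((Finset.range n).image u)
        have h' : (((Finset.range n).image u : Finset V) : Set V) = u '' Set.Iio n := by
          simp
        rw [h'] at h
        exact h.trans (Finset.card_image_le.trans (by simp))
      have hlt : Module.finrank ℝ X < Module.finrank ℝ V := by
        refine ((finrank_iterate_expand_le ops H _).trans ?_).trans_lt hV
        gcongr
        omega
      have hne : Xᗮ ≠ ⊥ := by
        intro h
        rw [Submodule.orthogonal_eq_bot_iff] at h
        rw [h, finrank_top] at hlt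
        exact lt_irrefl _ hlt
      obtain ⟨v, hv, hv0⟩ := Submodule.exists_mem_ne_zero_of_ne_bot hne
      have himg : ∀ k ≤ n, Function.update u n (‖v‖⁻¹ • v) '' Set.Iio k = u '' Set.Iio k :=
        fun k hk => Set.image_congr fun j hj => Function.update_of_ne
          (by have := Set.mem_Iio.1 hj; omega) _ _
      refine ⟨Function.update u n (‖v‖⁻¹ • v), fun k hk => ?_⟩
      rw [himg k (by omega)]
      rcases (Nat.lt_succ_iff.1 hk).eq_or_lt with rfl | hlt'
      · rw [Function.update_self]
        exact ⟨norm_smul_inv_norm (𝕜 := ℝ) hv0, Submodule.smul_mem _ _ hv⟩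
      · rw [Function.update_of_ne hlt'.ne]
        exact hu k hlt'
  obtain ⟨u, hu⟩ := key (N + 1) le_rfl
  exact ⟨u, fun k hk => hu k (Nat.lt_succ_of_le hk)⟩

end Expansion

/-! ### Speed of information between the two groups -/

section Propagation

variable {M : ℕ}

/-- The time at which a node at level `l` may learn the `m`-th direction of the chain, if the links
of even index are owned by levels at most `p` and the others by levels at least `p + δ`. -/
def revealTime (p δ m l : ℕ) : ℕ :=
  m * (δ + 1) + 1 + if Even m then l - p else p + δ - l

theorem revealTime_le {p δ m l l' : ℕ} (h1 : l ≤ l' + 1) (h2 : l' ≤ l + 1) :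
    revealTime p δ m l ≤ revealTime p δ m l' + 1 := by
  unfold revealTime
  split_ifs <;> omega

/-- Information about the chain needs to travel back and forth between the two groups. -/
theorem mem_iterate_expand_of_lt_revealTime {V : Type*} [NormedAddCommGroup V]
    [InnerProductSpace ℝ V] {ι : Type*} [Fintype ι]
    {ops : ι → V →ₗ[ℝ] V} {u : ℕ → V} {H N : ℕ}
    (hu : ∀ k ≤ N, ‖u k‖ = 1 ∧ u k ∈ ((expand ops)^[H] (Submodule.span ℝ (u '' Set.Iio k)))ᗮ)
    {G : SimpleGraph (Fin M)} {lev : Fin M → ℕ} {p δ : ℕ} (hδ : 1 ≤ δ)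
    (hlev : ∀ i j, G.Adj i j → lev i ≤ lev j + 1)
    {w : Fin M → ℕ → ℝ} (heven : ∀ i m, Even m → ¬ lev i ≤ p → w i m = 0)
    (hodd : ∀ i m, ¬ Even m → ¬ p + δ ≤ lev i → w i m = 0)
    {g : Fin M → V → V} (hg : ∀ i m x, w i m = 0 → (∀ j, m ≤ j → j ≤ N → inner ℝ (u j) x = 0) →
      g i x ∈ Submodule.span ℝ (u '' Set.Iio m))
    {x : ℕ → Fin M → V} (hx0 : ∀ i, x 0 i = 0)
    (hx : ∀ t < H, ∀ i, x (t + 1) i ∈ Submodule.span ℝ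
      ({y | ∃ c j k, G.Adj i j ∧ k ≤ t ∧ y = ops c (x k j)} ∪
       {y | ∃ c k, k ≤ t ∧ y = ops c (g i (x k i))} ∪ {y | ∃ c k, k ≤ t ∧ y = ops c (x k i)}))
    (t : ℕ) : t ≤ H → ∀ m ≤ N, ∀ i, t < revealTime p δ m (lev i) →
      x t i ∈ (expand ops)^[t] (Submodule.span ℝ (u '' Set.Iio m)) := by
  induction t using Nat.strong_induction_on with
  | _ t ih =>
  rcases t with _ | t
  · intro _ m _ i _
    rw [hx0]
    exact Submodule.zero_mem _
  intro ht m hm i hti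
  have happ : ∀ {k : ℕ} {y : V} (c : ι), k ≤ t →
      y ∈ (expand ops)^[k] (Submodule.span ℝ (u '' Set.Iio m)) →
      ops c y ∈ (expand ops)^[t + 1] (Submodule.span ℝ (u '' Set.Iio m)) := by
    intro k y c hk hy
    rw [Function.iterate_succ_apply']
    exact apply_mem_expand ops c (monotone_iterate_expand ops _ hk hy)
  refine (Submodule.span_le.2 ?_) (hx t (by omega) i)
  rintro y ((⟨c, j, k, hij, hk, rfl⟩ | ⟨c, k, hk, rfl⟩) | ⟨c, k, hk, rfl⟩)
  · have h := revealTime_le (p := p) (δ := δ) (m := m) (hlev i j hij) (hlev j i hij.symm)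
    exact happ c hk (ih k (by omega) (by omega) m hm j (by omega))
  · refine happ c (Nat.zero_le t) ?_
    -- A node without link `m` cannot leave the span of the first `m` directions. An owner of link
    -- `m` does not own link `m - 1` and lies at least `δ` levels from its owners; before its reveal
    -- time for `m` it does not know `u (m - 1)` either, so its gradient lies in the span of `u 0,
    -- …, u (m - 2)`.
    by_cases hw : w i m = 0
    · have hk' := ih k (by omega) (by omega) m hm i (by omega)
      exact hg i m _ hw fun j hmj hj =>
        inner_eq_zero_of_mem_iterate hu (by omega) hmj hj hk'
    · rcases m with _ | m
      · have h0 : lev i ≤ p := by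
          by_contra h
          exact hw (heven i 0 Even.zero h)
        simp only [revealTime, Even.zero, if_true, zero_mul] at hti
        omega
      · have hboth : w i m = 0 ∧ k < revealTime p δ m (lev i) := by
          have hmul : (m + 1) * (δ + 1) = m * (δ + 1) + (δ + 1) := by ring
          by_cases he : Even m
          · have he' : ¬ Even (m + 1) := by simpa [Nat.even_add_one] using he
            have hl : p + δ ≤ lev i := by
              by_contra h
              exact hw (hodd i _ he' h)
            refine ⟨heven i m he (by omega), ?_⟩
            simp only [revealTime, he', if_false, hmul] at hti
            simp only [revealTime, he, if_true]
            omega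
          · have he' : Even (m + 1) := by simpa [Nat.even_add_one] using he
            have hl : lev i ≤ p := by
              by_contra h
              exact hw (heven i _ he' h)
            refine ⟨hodd i m he (by omega), ?_⟩
            simp only [revealTime, he', if_true, hmul] at hti
            simp only [revealTime, he, if_false]
            omega
        have hk' := ih k (by omega) (by omega) m (by omega) i hboth.2
        have h := hg i m (x k i) hboth.1 fun j hmj hj =>
          inner_eq_zero_of_mem_iterate hu (by omega) hmj hj hk'
        exact Submodule.span_mono (Set.image_mono fun l (hl : l < m) => Nat.lt_succ_of_lt hl) h
  · exact happ c hk (ih k (by omega) (by omega) m hm i (by omega))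

end Propagation

/-! ### Reduction of both classes to one finite operator family -/

section Classes

variable {M : ℕ} {a : Algorithm M}

/-- By linearity a block applied to the sum of messages is the sum of its values on the single
messages. -/
theorem ClassA'.classA (h : ClassA' a) : ClassA a := by
  classical
  obtain ⟨o, ho⟩ := h
  refine ⟨⟨o.Q, fun G S t i _ k => o.Wsum G S t i k, o.Wgrad, o.Wself⟩,
    fun G S f hG hf t i => (Submodule.span_le.2 ?_) (ho G S f hG hf t i)⟩
  rintro y ((⟨k, hk, rfl⟩ | hy) | hy)
  · rw [map_sum]
    refine Submodule.sum_mem _ fun j hj => Submodule.subset_span (Or.inl (Or.inl ?_))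
    exact ⟨j, k, by simpa using hj, hk, rfl⟩
  · exact Submodule.subset_span (Or.inl (Or.inr hy))
  · exact Submodule.subset_span (Or.inr hy)

/-- The operators used up to time `H`, as one finite family. -/
def Operators.family (o : Operators M) (G : SimpleGraph (Fin M)) (S H : ℕ) :
    Fin 3 × Fin H × Fin H × Fin M × Fin M → (Vec S →ₗ[ℝ] Vec S)
  | (0, t, k, i, j) => o.Wmsg G S t i j k ∘ₗ o.Q G S k j
  | (1, t, k, i, _) => o.Wgrad G S t i k
  | (2, t, k, i, _) => o.Wself G S t i k

end Classes

/-! ### Rescaling: same smoothness, gap multiplied by the square of the scale -/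

section Rescaling

variable {M S : ℕ} {s U : ℝ}

/-- The problem `x ↦ s² h(x / s)`. -/
def rescale (s : ℝ) (h : Fin M → Vec S → ℝ) (i : Fin M) (x : Vec S) : ℝ := s ^ 2 * h i (s⁻¹ • x)

theorem hasGradientAt_rescale (hs : s ≠ 0) {h : Fin M → Vec S → ℝ}
    (hd : ∀ i, Differentiable ℝ (h i)) (i : Fin M) (x : Vec S) :
    HasGradientAt (rescale s h i) (s • gradient (h i) (s⁻¹ • x)) x := by
  have h1 := (hd i (s⁻¹ • x)).hasGradientAt.hasFDerivAt
  have h2 := (h1.comp x ((hasFDerivAt_id x).const_smul s⁻¹)).const_mul (s ^ 2)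
  rw [hasGradientAt_iff_hasFDerivAt]
  refine h2.congr_fderiv ?_
  ext y
  rw [InnerProductSpace.toDual_apply_apply, real_inner_smul_left]
  simp
  field_simp

theorem gradient_rescale (hs : s ≠ 0) {h : Fin M → Vec S → ℝ}
    (hd : ∀ i, Differentiable ℝ (h i)) (i : Fin M) (x : Vec S) :
    gradient (rescale s h i) x = s • gradient (h i) (s⁻¹ • x) :=
  (hasGradientAt_rescale hs hd i x).gradient

theorem avgObj_rescale (h : Fin M → Vec S → ℝ) (x : Fin M → Vec S) :
    avgObj (rescale s h) x = s ^ 2 * avgObj h (s⁻¹ • x) := by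
  simp only [avgObj, rescale, Pi.smul_apply]
  rw [← Finset.mul_sum]
  ring

theorem InProblemClass.rescale (hs : 0 < s) {h : Fin M → Vec S → ℝ} (hh : InProblemClass U h) :
    InProblemClass U (rescale s h) := by
  refine ⟨fun i x => (hasGradientAt_rescale hs.ne' hh.differentiable i x).differentiableAt,
    fun i => ?_, ?_⟩
  · have heq : {L : ℝ | 0 ≤ L ∧ ∀ x z, ‖gradient (DistOpt.rescale s h i) x -
        gradient (DistOpt.rescale s h i) z‖ ≤ L * ‖x - z‖} =
        {L : ℝ | 0 ≤ L ∧ ∀ x z, ‖gradient (h i) x - gradient (h i) z‖ ≤ L * ‖x - z‖} := by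
      ext L
      refine and_congr_right fun _ => ?_
      simp_rw [gradient_rescale hs.ne' hh.differentiable, ← smul_sub, norm_smul,
        Real.norm_of_nonneg hs.le]
      refine ⟨fun H x z => ?_, fun H x z => ?_⟩
      · have := H (s • x) (s • z)
        rw [inv_smul_smul₀ hs.ne', inv_smul_smul₀ hs.ne', ← smul_sub, norm_smul,
          Real.norm_of_nonneg hs.le, mul_left_comm] at this
        exact le_of_mul_le_mul_left this hs
      · have := H (s⁻¹ • x) (s⁻¹ • z)
        rw [← smul_sub, norm_smul, Real.norm_of_nonneg (inv_pos.2 hs).le, mul_left_comm] at this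
        calc _ ≤ s * (s⁻¹ * (L * ‖x - z‖)) := by gcongr
          _ = _ := mul_inv_cancel_left₀ hs.ne' _
    rw [heq]
    exact hh.lipschitz i
  · obtain ⟨b, hb⟩ := hh.bddBelow
    refine ⟨s ^ 2 * b, ?_⟩
    rintro _ ⟨x, rfl⟩
    rw [avgObj_rescale]
    exact mul_le_mul_of_nonneg_left (hb ⟨_, rfl⟩) (sq_nonneg s)

theorem initialGap_rescale (hs : 0 < s) {h : Fin M → Vec S → ℝ}
    (hd : ∀ i, Differentiable ℝ (h i)) :
    initialGap U (rescale s h) = s ^ 2 * initialGap U h := by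
  have hinf : (⨅ x, avgObj (rescale s h) x) = s ^ 2 * ⨅ x, avgObj h x := by
    simp_rw [avgObj_rescale]
    rw [Real.mul_iInf_of_nonneg (sq_nonneg s)]
    exact (MulAction.surjective₀ (inv_ne_zero hs.ne')).iInf_comp fun x => s ^ 2 * avgObj h x
  rw [initialGap, hinf]
  simp only [initialGap, gradient_rescale hs.ne' hd, avgObj_rescale, smul_zero, norm_smul,
    Real.norm_of_nonneg hs.le, mul_pow]
  rw [← Finset.mul_sum]
  ring

end Rescaling

/-! ### Distribution of the links among the nodes -/

section Weights

variable {M : ℕ}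

/-- The weights of the links: those of even index below `n` are shared by the nodes at level at
most `p`, those of odd index by the nodes at level at least `q`. -/
def linkWeight (κ : ℝ) (n p q : ℕ) (lev : Fin M → ℕ) (i : Fin M) (k : ℕ) : ℝ :=
  if k < n then
    if Even k then
      if lev i ≤ p then κ * M / (Finset.univ.filter fun i => lev i ≤ p).card else 0
    else if q ≤ lev i then κ * M / (Finset.univ.filter fun i => q ≤ lev i).card else 0
  else 0

variable {κ : ℝ} {n p q : ℕ} {lev : Fin M → ℕ}

theorem linkWeight_nonneg (hκ : 0 ≤ κ) (i : Fin M) (k : ℕ) :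
    0 ≤ linkWeight κ n p q lev i k := by
  unfold linkWeight
  split_ifs <;> positivity

theorem mul_div_card_le (hκ : 0 ≤ κ) {m : ℕ} (h : M ≤ 4 * m) : κ * M / m ≤ 4 * κ := by
  refine div_le_of_le_mul₀ (Nat.cast_nonneg m) (by positivity) ?_
  have : (M : ℝ) ≤ 4 * m := by exact_mod_cast h
  nlinarith

theorem linkWeight_le (hκ : 0 ≤ κ) (hp : M ≤ 4 * (Finset.univ.filter fun i => lev i ≤ p).card)
    (hq : M ≤ 4 * (Finset.univ.filter fun i => q ≤ lev i).card) (i : Fin M) (k : ℕ) :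
    linkWeight κ n p q lev i k ≤ 4 * κ := by
  unfold linkWeight
  split_ifs
  · exact mul_div_card_le hκ hp
  · positivity
  · exact mul_div_card_le hκ hq
  · positivity
  · positivity

theorem linkWeight_self (i : Fin M) : linkWeight κ n p q lev i n = 0 := by simp [linkWeight]

theorem sum_linkWeight (hM : 0 < M) (hp : M ≤ 4 * (Finset.univ.filter fun i => lev i ≤ p).card)
    (hq : M ≤ 4 * (Finset.univ.filter fun i => q ≤ lev i).card) {k : ℕ} (hk : k < n) :
    ∑ i, linkWeight κ n p q lev i k = κ * M := by
  have key : ∀ (P : Fin M → Prop) [DecidablePred P], M ≤ 4 * (Finset.univ.filter P).card →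
      ∑ i, (if P i then κ * M / (Finset.univ.filter P).card else 0) = κ * M := by
    intro P _ h
    rw [← Finset.sum_filter, Finset.sum_const, nsmul_eq_mul]
    have : (Finset.univ.filter P).card ≠ 0 := fun h0 => by rw [h0] at h; omega
    exact mul_div_cancel₀ _ (Nat.cast_ne_zero.2 this)
  simp only [linkWeight, if_pos hk]
  split_ifs
  · exact key _ hp
  · exact key _ hq

end Weights

/-! ### Initial gap of the chain problem -/

section Gap

variable {M S : ℕ} {U : ℝ} {n : ℕ} {u : ℕ → Vec S} {w : Fin M → ℕ → ℝ}

theorem inProblemClass_chainFun (hu : Orthonormal ℝ fun k : Fin (n + 1) => u k) (hU : 0 ≤ U)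
    (hw0 : ∀ i k, 0 ≤ w i k) (hw1 : ∀ i k, 11 * w i k ≤ U) (hwn : ∀ i, w i n = 0) :
    InProblemClass U fun i => chainFun U n (w i) u := by
  refine ⟨fun i => differentiable_chainFun (hwn i), fun i =>
    isLeast_lipschitz_chainFun hu hU (hw0 i) (hw1 i) (hwn i),
    (1 / M) * ∑ i, -(4 * ∑ k ∈ Finset.range n, w i k), ?_⟩
  rintro _ ⟨x, rfl⟩
  unfold avgObj
  gcongr with i
  exact neg_le_chainFun hU (hw0 i) (x i)

/-- Each link is at least `-4`. Each local gradient at `0` has norm `w i 0 / 2 ≤ U / 22`, which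
gives `(U / 22)² / U = U / 484`. -/
theorem initialGap_chainFun_le (hu : Orthonormal ℝ fun k : Fin (n + 1) => u k) (hM : 0 < M)
    (hn : 0 < n) (hU : 0 < U) (hw0 : ∀ i k, 0 ≤ w i k) (hw1 : ∀ i k, 11 * w i k ≤ U)
    (hwn : ∀ i, w i n = 0) {κ : ℝ} (hw : ∀ k < n, ∑ i, w i k = κ * M) :
    initialGap U (fun i => chainFun U n (w i) u) ≤ 4 * n * κ + U / 484 := by
  have hM' : (0 : ℝ) < M := Nat.cast_pos.2 hM
  have h1 : avgObj (fun i => chainFun U n (w i) u) 0 ≤ 0 :=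
    mul_nonpos_of_nonneg_of_nonpos (by positivity)
      (Finset.sum_nonpos fun i _ => chainFun_zero_le (hw0 i))
  have h2 : -(4 * n * κ) ≤ ⨅ x, avgObj (fun i => chainFun U n (w i) u) x := by
    refine le_ciInf fun x => ?_
    have hsum : ∑ i, ∑ k ∈ Finset.range n, w i k = n * (κ * M) := by
      rw [Finset.sum_comm, Finset.sum_congr rfl fun k hk => hw k (Finset.mem_range.1 hk)]
      simp
    calc -(4 * n * κ) = (1 / M) * ∑ i, -(4 * ∑ k ∈ Finset.range n, w i k) := by
          rw [Finset.sum_neg_distrib, ← Finset.mul_sum, hsum]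
          field_simp
      _ ≤ _ := by
          unfold avgObj
          gcongr with i
          exact neg_le_chainFun hU.le (hw0 i) (x i)
  have h3 : (∑ i, ‖gradient (chainFun U n (w i) u) 0‖ ^ 2) / (M * U) ≤ U / 484 := by
    have hu0 : ‖u 0‖ = 1 := hu.1 0
    have h4 : ∀ i, ‖gradient (chainFun U n (w i) u) 0‖ ^ 2 ≤ (U / 22) ^ 2 := by
      intro i
      rw [gradient_chainFun_zero hn (hwn i), norm_smul, hu0, mul_one, norm_neg,
        Real.norm_of_nonneg (by linarith [hw0 i 0])]
      refine pow_le_pow_left₀ (by linarith [hw0 i 0]) ?_ 2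
      linarith [hw1 i 0]
    rw [div_le_iff₀ (by positivity)]
    refine (Finset.sum_le_sum fun i _ => h4 i).trans (le_of_eq ?_)
    rw [Finset.sum_const, Finset.card_univ, Fintype.card_fin, nsmul_eq_mul]
    ring
  unfold initialGap
  linarith

/-- An owner of link `0` has nonzero gradient at `0`. Positivity allows rescaling to any prescribed
gap. -/
theorem initialGap_chainFun_pos (hu : Orthonormal ℝ fun k : Fin (n + 1) => u k) (hM : 0 < M)
    (hn : 0 < n) (hU : 0 < U) (hw0 : ∀ i k, 0 ≤ w i k) (hw1 : ∀ i k, 11 * w i k ≤ U)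
    (hwn : ∀ i, w i n = 0) {κ : ℝ} (hκ : 0 < κ) (hw : ∀ k < n, ∑ i, w i k = κ * M) :
    0 < initialGap U (fun i => chainFun U n (w i) u) := by
  have hM' : (0 : ℝ) < M := Nat.cast_pos.2 hM
  have hu0 : ‖u 0‖ = 1 := hu.1 0
  have h1 := ciInf_le (inProblemClass_chainFun hu hU.le hw0 hw1 hwn).bddBelow 0
  have h2 : 0 < ∑ i, ‖gradient (chainFun U n (w i) u) 0‖ ^ 2 := by
    obtain ⟨i, -, hi⟩ : ∃ i ∈ Finset.univ, w i 0 ≠ 0 := by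
      refine Finset.exists_ne_zero_of_sum_ne_zero ?_
      rw [hw 0 hn]
      positivity
    have hgi : 0 < ‖gradient (chainFun U n (w i) u) 0‖ ^ 2 := by
      rw [gradient_chainFun_zero hn (hwn i), norm_smul, hu0, mul_one]
      exact pow_pos (norm_pos_iff.2 (neg_ne_zero.2 (div_ne_zero hi two_ne_zero))) 2
    exact hgi.trans_le (Finset.single_le_sum
      (f := fun i => ‖gradient (chainFun U n (w i) u) 0‖ ^ 2) (fun _ _ => sq_nonneg _)
      (Finset.mem_univ i))
  have h3 : 0 < (∑ i, ‖gradient (chainFun U n (w i) u) 0‖ ^ 2) / (M * U) :=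
    div_pos h2 (mul_pos hM' hU)
  unfold initialGap
  linarith

end Gap

/-! ### Assembly of the lower bound -/

section LowerBound

variable {M : ℕ}

/-- For every algorithm there is a problem on which the quality stays poor until the last direction
of the chain has been revealed. -/
theorem exists_hard_problem {D : ℕ} (hM : 2 ≤ M) {U Δ : ℝ} (hU0 : 0 < U) (hU1 : U < 1)
    (hΔ : 0 < Δ) {a : Algorithm M} (ha : ClassA a) (ha0 : a.StartsAtZero)
    {G : SimpleGraph (Fin M)} (hG : InNetworkClass D G) {lev : Fin M → ℕ} {p δ : ℕ}
    (hlev : ∀ i j, G.Adj i j → lev i ≤ lev j + 1) (hδ : 1 ≤ δ)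
    (hp : M ≤ 4 * (Finset.univ.filter fun i => lev i ≤ p).card)
    (hq : M ≤ 4 * (Finset.univ.filter fun i => p + δ ≤ lev i).card) (T : ℕ) :
    ∃ (S : ℕ) (f : Fin M → Vec S → ℝ), InProblemClass U f ∧ initialGap U f = Δ ∧
      ∀ t ≤ T * (δ + 1), U * Δ ≤ 1408 * (4 * (T + 1) + 1 / 11) * quality G U f (a G S f t) := by
  obtain ⟨o, ho⟩ := ha
  set H := T * (δ + 1) with hH
  set n := T + 1 with hn
  -- One more than the largest dimension that `H` expansions of `n` directions can fill.
  set S := (1 + Fintype.card (Fin 3 × Fin H × Fin H × Fin M × Fin M)) ^ H * n + 1 with hS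
  set ops := o.family G S H with hops
  obtain ⟨u, hu⟩ := exists_adapted_unit_vectors ops H n (by simp [hS])
  have hon := orthonormal_of_adapted hu
  -- Each group holds a quarter of the nodes, so single weights are at most `4κ = U / 11`, as the
  -- smoothness bound requires.
  set κ := U / 44 with hκ
  have hκ0 : 0 < κ := by positivity
  set w := linkWeight κ n p (p + δ) lev with hw
  have hw0 : ∀ i k, 0 ≤ w i k := linkWeight_nonneg hκ0.le
  have hw1 : ∀ i k, 11 * w i k ≤ U := fun i k => by
    have := linkWeight_le (n := n) hκ0.le hp hq i k
    rw [← hw] at this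
    linarith
  have hwn : ∀ i, w i n = 0 := linkWeight_self
  have hwsum : ∀ k < n, ∑ i, w i k = κ * M := fun k hk => sum_linkWeight (by omega) hp hq hk
  set h : Fin M → Vec S → ℝ := fun i => chainFun U n (w i) u with hh
  have hclass : InProblemClass U h := inProblemClass_chainFun hon hU0.le hw0 hw1 hwn
  set C := initialGap U h with hC
  have hCpos : 0 < C :=
    initialGap_chainFun_pos hon (by omega) (by omega) hU0 hw0 hw1 hwn hκ0 hwsum
  have hCle : C ≤ 4 * n * κ + U / 484 :=
    initialGap_chainFun_le hon (by omega) (by omega) hU0 hw0 hw1 hwn hwsum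
  set s := √(Δ / C) with hs
  have hs0 : 0 < s := Real.sqrt_pos.2 (by positivity)
  have hs2 : s ^ 2 * C = Δ := by
    rw [hs, Real.sq_sqrt (by positivity), div_mul_cancel₀ _ hCpos.ne']
  set f := rescale s h with hf
  have hfclass : InProblemClass U f := hclass.rescale hs0
  refine ⟨S, f, hfclass, (initialGap_rescale hs0 hclass.differentiable).trans hs2, fun t ht => ?_⟩
  have hgrad : ∀ i x, gradient (f i) x = s • gradient (h i) (s⁻¹ • x) :=
    gradient_rescale hs0.ne' hclass.differentiable
  have hmem := mem_iterate_expand_of_lt_revealTime hu hδ hlev (p := p) (w := w)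
    (g := fun i => gradient (f i)) (x := a G S f)
    (fun i m hm hl => by simp [hw, linkWeight, hm, hl])
    (fun i m hm hl => by simp [hw, linkWeight, hm, hl])
    (fun i m x hm hx => by
      rw [hgrad]
      refine Submodule.smul_mem _ _ (gradient_chainFun_mem_span (hwn i) hm fun j hmj hj => ?_)
      rw [real_inner_smul_right, hx j hmj hj, mul_zero])
    (fun i => ha0 G S f i)
    (fun t ht i => by
      refine Submodule.span_mono ?_ (ho G S f hG.connected hfclass.differentiable t i)
      rintro y ((⟨j, k, hij, hk, rfl⟩ | ⟨k, hk, rfl⟩) | ⟨k, hk, rfl⟩)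
      · exact Or.inl (Or.inl ⟨(0, ⟨t, ht⟩, ⟨k, by omega⟩, i, j), j, k, hij, hk, rfl⟩)
      · exact Or.inl (Or.inr ⟨(1, ⟨t, ht⟩, ⟨k, by omega⟩, i, i), k, hk, rfl⟩)
      · exact Or.inr ⟨(2, ⟨t, ht⟩, ⟨k, by omega⟩, i, i), k, hk, rfl⟩)
    t ht T (by omega)
  have hinner : ∀ i, inner ℝ (u T) (a G S f t i) = 0 := fun i =>
    inner_eq_zero_of_mem_iterate hu ht le_rfl (by omega)
      (hmem i (by unfold revealTime; omega))
  set xb := (1 / (M : ℝ)) • ∑ j, a G S f t j with hxb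
  have hxb0 : inner ℝ (u T) (s⁻¹ • xb) = 0 := by
    rw [hxb, real_inner_smul_right, real_inner_smul_right, inner_sum]
    simp [hinner]
  have hlow := le_norm_sum_gradient_chainFun (U := U) hon w (by positivity) hwsum hwn
    (by omega : T < n) hxb0
  have hM' : (0 : ℝ) < M := by positivity
  have hnorm : s * κ / 4 ≤ ‖(1 / (M : ℝ)) • ∑ i, gradient (f i) xb‖ := by
    simp_rw [hgrad]
    rw [← Finset.smul_sum, norm_smul, norm_smul, Real.norm_of_nonneg hs0.le,
      Real.norm_of_nonneg (by positivity)]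
    calc s * κ / 4 = 1 / M * (s * (κ * M / 4)) := by field_simp
      _ ≤ _ := by gcongr
  have hqual := norm_sq_avg_gradient_le_quality hG.connected hM hU0 hU1 f
    (fun i => (hfclass.lipschitz i).1.2) (a G S f t)
  have hsq : (s * κ / 4) ^ 2 ≤ 2 * quality G U f (a G S f t) :=
    (pow_le_pow_left₀ (by positivity) hnorm 2).trans hqual
  have hCU : C ≤ U / 44 * (4 * (T + 1) + 1 / 11) := by
    refine hCle.trans (le_of_eq ?_)
    rw [hn, hκ]
    push_cast
    ring
  calc U * Δ = U * (s ^ 2 * C) := by rw [hs2]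
    _ ≤ U * (s ^ 2 * (U / 44 * (4 * (T + 1) + 1 / 11))) := by gcongr
    -- Here `κ / 4 = U / 176` and `176² / 44 = 704`.
    _ = 704 * (4 * (T + 1) + 1 / 11) * (s * κ / 4) ^ 2 := by rw [hκ]; ring
    _ ≤ 704 * (4 * (T + 1) + 1 / 11) * (2 * quality G U f (a G S f t)) := by gcongr
    _ = _ := by ring

theorem le_hStar {S : ℕ} {G : SimpleGraph (Fin M)} {U ε : ℝ} {f : Fin M → Vec S → ℝ}
    {x : ℕ → Fin M → Vec S} {t : ℕ} (ht : 1 ≤ t) (h : ∀ s ≤ t, ε ≤ quality G U f (x s)) :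
    ε ≤ hStar G U f x t := by
  refine le_csInf ⟨_, 1, ⟨le_rfl, ht⟩, rfl⟩ ?_
  rintro _ ⟨s, hs, rfl⟩
  exact h s hs.2

end LowerBound

end DistOpt

end

theorem corollary3p1 (M D : ℕ) (hD : 1 ≤ D) (hDM : D + 1 ≤ M)
    (U ε Δ : ℝ) (hU0 : 0 < U) (hU1 : U < 1) (hε : 0 < ε) (hΔ : 0 < Δ)
    (a : DistOpt.Algorithm M) (ha : DistOpt.ClassA a ∨ DistOpt.ClassA' a)
    (ha0 : a.StartsAtZero) :
    ∃ (S : ℕ) (f : Fin M → DistOpt.Vec S → ℝ) (G : SimpleGraph (Fin M)),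
      DistOpt.InProblemClass U f ∧ DistOpt.InNetworkClass D G ∧
      DistOpt.initialGap U f = Δ ∧
      ∀ t : ℕ, 1 ≤ t → DistOpt.hStar G U f (a G S f) t < ε →
        (D : ℝ) / 3 * (⌊DistOpt.initialGap U f * U / (1650 * Real.pi ^ 2) * ε⁻¹⌋ : ℝ) ≤ t ∧
        √(((D : ℝ) - 1) / (2 * M)) / (3 * √(DistOpt.spectralGap G)) *
          (⌊DistOpt.initialGap U f * U / (1650 * Real.pi ^ 2) * ε⁻¹⌋ : ℝ) ≤ t := by
  open DistOpt in
  have ha' : ClassA a := ha.elim id ClassA'.classA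
  obtain ⟨G, lev, p, δ, hG, hlev, hδ, hDδ, hp, hq, hgap⟩ := exists_network M D hD hDM
  have hr0 : 0 ≤ Δ * U / (1650 * Real.pi ^ 2) * ε⁻¹ := by positivity
  obtain ⟨T, hT⟩ := Int.eq_ofNat_of_zero_le (Int.floor_nonneg.2 hr0)
  obtain ⟨S, f, hf, hfΔ, hqual⟩ :=
    exists_hard_problem (by omega) hU0 hU1 hΔ ha' ha0 hG hlev hδ hp hq T
  refine ⟨S, f, G, hf, hG, hfΔ, fun t ht hlt => ?_⟩
  rw [hfΔ, hT, Int.cast_natCast]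
  have hmain : (D : ℝ) / 3 * T ≤ t := by
    -- For `T = 0` the bound is void; `T ≥ 1` is needed to absorb the constants of `4 * (T + 1) + 1
    -- / 11`.
    rcases Nat.eq_zero_or_pos T with rfl | hT0
    · simp
    have hT1 : (1 : ℝ) ≤ T := by exact_mod_cast hT0
    have hTle : (T : ℝ) ≤ Δ * U / (1650 * Real.pi ^ 2) * ε⁻¹ := by
      have := Int.floor_le (Δ * U / (1650 * Real.pi ^ 2) * ε⁻¹)
      rw [hT] at this
      exact_mod_cast this
    -- `14850 = 1650 * 9`, from `π² ≥ 9`.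
    have hpi : 14850 * (T * ε) ≤ Δ * U := by
      rw [← div_eq_mul_inv, div_div, le_div_iff₀ (by positivity)] at hTle
      have h9 : 9 ≤ Real.pi ^ 2 := by nlinarith [Real.pi_gt_three]
      nlinarith [mul_le_mul_of_nonneg_left h9 (mul_pos (by linarith : (0 : ℝ) < T) hε).le]
    have hlate : T * (δ + 1) < t := by
      by_contra hle
      push Not at hle
      refine hlt.not_ge (le_hStar ht fun s hs => ?_)
      have h1 := hqual s (hs.trans hle)
      by_contra hlt'
      push Not at hlt'
      have h2 : 1408 * (4 * (T + 1) + 1 / 11) * quality G U f (a G S f s) <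
          1408 * (4 * (T + 1) + 1 / 11) * ε := by gcongr
      -- For `T ≥ 1`, `1408 * (4 * (T + 1) + 1 / 11) ≤ 11392 * T`, below `14850 * T`.
      nlinarith
    have h3 : (D : ℝ) ≤ 3 * (δ + 1) := by exact_mod_cast hDδ
    have h4 : (T : ℝ) * (δ + 1) ≤ t := by exact_mod_cast hlate.le
    nlinarith
  -- The spectral bound is weaker than the diameter bound because `(D - 1) / (2M) ≤ D² ξ(G)`.
  refine ⟨hmain, le_trans (mul_le_mul_of_nonneg_right ?_ (Nat.cast_nonneg T)) hmain⟩
  refine div_le_of_le_mul₀ (by positivity) (by positivity) ?_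
  calc √(((D : ℝ) - 1) / (2 * M)) ≤ √(D ^ 2 * spectralGap G) := Real.sqrt_le_sqrt hgap
    _ = D * √(spectralGap G) := by
        rw [Real.sqrt_mul (sq_nonneg _), Real.sqrt_sq (Nat.cast_nonneg D)]
    _ = _ := by ring
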